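/- Let $I\subseteq\mathbb{R}$ be an interval (open, closed or half-open, possibly infinite) with $I\neq\mathbb{R}$, and let $f,g:I\to I$ be Möbius maps, i.e. each is given on $I$ by a formula $x\mapsto (Ax+B)/(Cx+D)$ with real $A,B,C,D$, $AD-BC\ne 0$, and denominator nowhere zero on $I$. Suppose that neither $f$ nor $g$ maps $I$ onto $I$. Let $\langle f,g\rangle$ be the semigroup generated by $f$ and $g$ under composition and, for $x\in I$, let $\Omega_x=\{h(x): h\in\langle f,g\rangle\}$. Let $\partial I\subset[-\infty,\infty]$ be the set of the two end points of $I$, which may be infinite and need not belong to $I$. For $h:I\to I$, write $o(h)$ for the attracting fixed point of $h$: a point $\theta$ of $I\cup\partial I$ such that $h^n(y)\to\theta$ as $n\to\infty$ for all $y\in I$ near $\theta$ (for $\theta=\infty$: for all large enough $y\in I$; similarly for $-\infty$); whenever $o(h)$ is written it is implied that it exists. Then for every $x\in I$, the orbit $\Omega_x$ is dense in $I$ if and only if $\mathrm{Im}(f)\cup\mathrm{Im}(g)$ is dense in $I$ and one of the following occurs: (i) both $f$ and $g$ are increasing and $\{o(f),o(g)\}=\partial I$; (ii) exactly one of $f$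 and $g$ is increasing, and the attracting fixed point of the increasing one exists and belongs to $\partial I$; (iii) both $f$ and $g$ are decreasing and $\{o(f\circ g),o(g\circ f)\}=\partial I$. Moreover, if $I$ is compact, the condition that $\mathrm{Im}(f)\cup\mathrm{Im}(g)$ is dense in $I$ can be replaced by $\mathrm{Im}(f)\cup\mathrm{Im}(g)=I$: for every $x\in I$, the orbit $\Omega_x$ is dense in $I$ if and only if $\mathrm{Im}(f)\cup\mathrm{Im}(g)=I$ and one of (i), (ii), (iii) occurs. -/

import Mathlib

open Set Filter Topology

/-- `f : I → I` belongs to `𝓕_I`: it is given on `I` by a formula `(A x + B) / (C x + D)` with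
`A D - B C ≠ 0` and with a denominator that does not vanish on `I`. -/
def IsMobius {I : Set ℝ} (f : I → I) : Prop :=
  ∃ A B C D : ℝ, A * D - B * C ≠ 0 ∧
    ∀ x : I, C * (x : ℝ) + D ≠ 0 ∧ ((f x : I) : ℝ) = (A * (x : ℝ) + B) / (C * (x : ℝ) + D)

/-- The semigroup `⟨f, g⟩` of self-maps of `I` generated by `f` and `g` under composition
(multiplication in `Function.End` is composition). -/
def semigroupGen {I : Set ℝ} (f g : I → I) : Subsemigroup (Function.End I) :=
  Subsemigroup.closure ({f, g} : Set (Function.End I))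

/-- The orbit `Ω_x = {h x : h ∈ ⟨f, g⟩}`. -/
def orbit {I : Set ℝ} (f g : I → I) (x : I) : Set I :=
  {y | ∃ h : I → I, h ∈ semigroupGen f g ∧ h x = y}

/-- A real interval seen in the extended real line. -/
def extSet (I : Set ℝ) : Set EReal := (fun r : ℝ => (r : EReal)) '' I

/-- `∂I`, the set of the two end points of the interval `I`, possibly `-∞` or `∞`. -/
def endPoints (I : Set ℝ) : Set EReal := {sInf (extSet I), sSup (extSet I)}

/-- `θ = o(f)`: the point `θ` lies in `I` or is an end point of `I` (possibly infinite), and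
`f^n(x) → θ` for all `x ∈ I` near `θ` (for `θ = ∞`: for all large enough `x ∈ I`). -/
def IsAttracting {I : Set ℝ} (f : I → I) (θ : EReal) : Prop :=
  θ ∈ closure (extSet I) ∧
    ∃ U ∈ 𝓝 θ, ∀ x : I, ((x : ℝ) : EReal) ∈ U →
      Tendsto (fun n : ℕ => (((f^[n] x : I) : ℝ) : EReal)) atTop (𝓝 θ)

/-- `{o(f), o(g)} = ∂I`; in particular both attracting points exist. -/
def AttractingPairEqEndPoints {I : Set ℝ} (f g : I → I) : Prop :=
  ∃ p q : EReal, IsAttracting f p ∧ IsAttracting g q ∧ ({p, q} : Set EReal) = endPoints I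

/-- `o(f)` exists and `o(f) ∈ ∂I`. -/
def AttractingMemEndPoints {I : Set ℝ} (f : I → I) : Prop :=
  ∃ p : EReal, IsAttracting f p ∧ p ∈ endPoints I

/-- One of the three conditions (i), (ii), (iii) holds. -/
def DynamicalCondition {I : Set ℝ} (f g : I → I) : Prop :=
  (StrictMono f ∧ StrictMono g ∧ AttractingPairEqEndPoints f g) ∨
  ((StrictMono f ∧ ¬ StrictMono g ∧ AttractingMemEndPoints f) ∨
    (StrictMono g ∧ ¬ StrictMono f ∧ AttractingMemEndPoints g)) ∨
  (StrictAnti f ∧ StrictAnti g ∧ AttractingPairEqEndPoints (f ∘ g) (g ∘ f))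

/-! The chart `e`, inverse to the logarithm of a quotient of two affine forms, identifies the
interior of `I`, with its hyperbolic metric, with the real line. There a Möbius self-map that is not
onto becomes a strict contraction (`IsExpMobius.strictlyContracting`), and an increasing one is
attracted to an end point exactly when it moves every point of the line towards that end. If the two
ranges have dense union, one contraction has range bounded above and unbounded below, and the other
the opposite (`bdd_range_of_dense`).

Sufficiency: let `K` be a nonempty closed invariant subset of the line. The pushing makes `K`
unbounded on both sides. If a gap of `K` contains `f w` or `g w`, the gap around `w` is strictly
longer; and the pushing lets every gap be pulled back, without loss of length, to one that meets a
fixed compact interval. So if there were gaps, there would be a longest one. By density it meets the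
image of `f` or `g`, and a preimage then lies in a longer gap, a contradiction
(`eq_univ_of_mapsTo_of_recurrent`).

Necessity: a dense orbit makes the union of the ranges dense. If the dynamical condition fails, some
ray or compact interval is invariant and traps the orbit
(`exists_mapsTo_of_not_lineDynamicalCondition`). The end points that belong to `I` are outside the
chart; they are at most two, and their images form a finite set that the trap can include. -/

/-! ### Strict contractions of the line -/

/-- A self-map of the line that strictly decreases all distances. -/
def StrictlyContracting (f : ℝ → ℝ) : Prop := ∀ u v : ℝ, u < v → |f v - f u| < v - u

namespace StrictlyContracting

variable {f g : ℝ → ℝ}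

theorem abs_sub_le (hf : StrictlyContracting f) (u v : ℝ) : |f u - f v| ≤ |u - v| := by
  rcases lt_trichotomy u v with h | rfl | h
  · rw [abs_sub_comm, abs_sub_comm u, abs_of_pos (sub_pos.2 h)]
    exact (hf u v h).le
  · simp
  · rw [abs_of_pos (sub_pos.2 h)]
    exact (hf v u h).le

theorem continuous (hf : StrictlyContracting f) : Continuous f := by
  have : LipschitzWith 1 f := LipschitzWith.of_dist_le_mul fun x y => by
    simpa [Real.dist_eq] using hf.abs_sub_le x y
  exact this.continuous

theorem sub_lt (hf : StrictlyContracting f) {u v : ℝ} (h : u < v) : f v - f u < v - u :=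
  (le_abs_self _).trans_lt (hf u v h)

theorem comp (hf : StrictlyContracting f) (hg : StrictlyContracting g) :
    StrictlyContracting (f ∘ g) := fun u v h => by
  have h1 := hf.abs_sub_le (g v) (g u)
  exact h1.trans_lt (hg u v h)

theorem neg_conj (hf : StrictlyContracting f) : StrictlyContracting fun x => -f (-x) :=
  fun u v h => by
    have := hf (-v) (-u) (neg_lt_neg h)
    have e : -f (-v) - -f (-u) = f (-u) - f (-v) := by ring
    simp only [e]
    linarith

/-- A point moved to the right forces every point to its left to be moved to the right. -/
theorem le_of_le (hf : StrictlyContracting f) {y z : ℝ} (hz : z ≤ f z) (h : y ≤ z) : y ≤ f y := by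
  rcases h.eq_or_lt with rfl | h
  · exact hz
  · have := hf.sub_lt h
    linarith

theorem ge_of_ge (hf : StrictlyContracting f) {y z : ℝ} (hz : f z ≤ z) (h : z ≤ y) : f y ≤ y := by
  rcases h.eq_or_lt with rfl | h
  · exact hz
  · have := hf.sub_lt h
    linarith

end StrictlyContracting

/-! ### Maps without fixed points: iterates and fundamental domains -/

/-- Otherwise the infimum would belong to `K` and be moved below itself. -/
theorem not_bddBelow_of_mapsTo {f : ℝ → ℝ} (hlt : ∀ y, f y < y) {K : Set ℝ} (hK : IsClosed K)
    (hne : K.Nonempty) (hm : MapsTo f K K) : ¬ BddBelow K := fun hb =>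
  (hlt (sInf K)).not_ge (csInf_le hb (hm (hK.csInf_mem hne hb)))

theorem not_bddAbove_of_mapsTo {f : ℝ → ℝ} (hlt : ∀ y, y < f y) {K : Set ℝ} (hK : IsClosed K)
    (hne : K.Nonempty) (hm : MapsTo f K K) : ¬ BddAbove K := fun hb =>
  (hlt (sSup K)).not_ge (le_csSup hb (hm (hK.csSup_mem hne hb)))

theorem tendsto_iterate_atBot {f : ℝ → ℝ} (hf : Continuous f) (hlt : ∀ y, f y < y) (z : ℝ) :
    Tendsto (fun n => f^[n] z) atTop atBot := by
  have hanti : Antitone fun n => f^[n] z := antitone_nat_of_succ_le fun n => by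
    rw [Function.iterate_succ_apply']
    exact (hlt _).le
  refine tendsto_atTop_atBot_of_antitone hanti fun b => ?_
  by_contra! h
  have hm : MapsTo f (range fun n => f^[n] z) (range fun n => f^[n] z) := by
    rintro _ ⟨n, rfl⟩
    exact ⟨n + 1, Function.iterate_succ_apply' f n z⟩
  refine not_bddBelow_of_mapsTo hlt isClosed_closure (range_nonempty _).closure
    (hm.closure hf) (BddBelow.closure ⟨b, ?_⟩)
  rintro _ ⟨n, rfl⟩
  exact (h n).le

theorem tendsto_iterate_atTop {f : ℝ → ℝ} (hf : Continuous f) (hlt : ∀ y, y < f y) (z : ℝ) :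
    Tendsto (fun n => f^[n] z) atTop atTop := by
  have hmono : Monotone fun n => f^[n] z := monotone_nat_of_le_succ fun n => by
    rw [Function.iterate_succ_apply']
    exact (hlt _).le
  refine tendsto_atTop_atTop_of_monotone hmono fun b => ?_
  by_contra! h
  have hm : MapsTo f (range fun n => f^[n] z) (range fun n => f^[n] z) := by
    rintro _ ⟨n, rfl⟩
    exact ⟨n + 1, Function.iterate_succ_apply' f n z⟩
  refine not_bddAbove_of_mapsTo hlt isClosed_closure (range_nonempty _).closure
    (hm.closure hf) (BddAbove.closure ⟨b, ?_⟩)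
  rintro _ ⟨n, rfl⟩
  exact (h n).le

/-- `[f z, z]` is a fundamental domain on `(-∞, z]`. -/
theorem exists_mem_Icc_le_of_lt {f : ℝ → ℝ} (hf : Continuous f) (hlt : ∀ y, f y < y)
    {l : ℝ → ℝ} (hl : ∀ w, l (f w) ≤ l w) {z w : ℝ} (hw : w ≤ z) :
    ∃ w' ∈ Icc (f z) z, l w ≤ l w' := by
  have hl' : ∀ n w, l (f^[n] w) ≤ l w := by
    intro n
    induction n with
    | zero => exact fun w => le_rfl
    | succ n ih => exact fun w => (ih (f w)).trans (hl w)
  -- At the first such exponent `n + 1`, the point `w` lies between `f^[n] (f z)` and `f^[n] z`, so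
  -- it is the image under `f^[n]` of a point of `[f z, z]`.
  have hex : ∃ n, f^[n] z ≤ w :=
    ((tendsto_iterate_atBot hf hlt z).eventually (eventually_le_atBot w)).exists
  classical
  rcases hn : Nat.find hex with _ | n
  · have h0 := Nat.find_spec hex
    rw [hn] at h0
    have : w = z := le_antisymm hw h0
    exact ⟨z, ⟨(hlt z).le, le_rfl⟩, this ▸ le_rfl⟩
  · have h1 := Nat.find_spec hex
    rw [hn] at h1
    have h2 : ¬ f^[n] z ≤ w := Nat.find_min hex (by omega)
    obtain ⟨w', hw', rfl⟩ := intermediate_value_Icc (hlt z).le (hf.iterate n).continuousOn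
      (show w ∈ Icc (f^[n] (f z)) (f^[n] z) from ⟨h1, (not_le.1 h2).le⟩)
    exact ⟨w', hw', hl' n w'⟩

theorem exists_mem_Icc_le_of_gt {f : ℝ → ℝ} (hf : Continuous f) (hlt : ∀ y, y < f y)
    {l : ℝ → ℝ} (hl : ∀ w, l (f w) ≤ l w) {z w : ℝ} (hw : z ≤ w) :
    ∃ w' ∈ Icc z (f z), l w ≤ l w' := by
  obtain ⟨w', hw', h⟩ := exists_mem_Icc_le_of_lt (f := fun x => -f (-x)) (l := fun x => l (-x))
    (by fun_prop) (fun y => by linarith [hlt (-y)]) (fun w => by simpa using hl (-w))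
    (neg_le_neg hw)
  simp only [neg_neg, mem_Icc] at hw' h
  exact ⟨-w', ⟨by linarith, by linarith⟩, h⟩

/-! ### Gaps of a closed invariant set -/

/-- The length of the gap of `K` around `w`. -/
noncomputable def gapLength (K : Set ℝ) (w : ℝ) : ℝ := sInf (K ∩ Ici w) - sSup (K ∩ Iic w)

section Gap

variable {K : Set ℝ}

theorem sInf_inter_Ici_mem (hK : IsClosed K) (ha : ¬ BddAbove K) (w : ℝ) : sInf (K ∩ Ici w) ∈ K ∩ Ici w := by
  rw [not_bddAbove_iff] at ha
  obtain ⟨k, hk, hwk⟩ := ha w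
  exact (hK.inter isClosed_Ici).csInf_mem ⟨k, hk, hwk.le⟩ ⟨w, fun y hy => hy.2⟩

theorem sSup_inter_Iic_mem (hK : IsClosed K) (hb : ¬ BddBelow K) (w : ℝ) : sSup (K ∩ Iic w) ∈ K ∩ Iic w := by
  rw [not_bddBelow_iff] at hb
  obtain ⟨k, hk, hwk⟩ := hb w
  exact (hK.inter isClosed_Iic).csSup_mem ⟨k, hk, hwk.le⟩ ⟨w, fun y hy => hy.2⟩

theorem gapLength_le {u v w : ℝ} (hu : u ∈ K) (hv : v ∈ K) (huw : u ≤ w) (hwv : w ≤ v) :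
    gapLength K w ≤ v - u :=
  sub_le_sub (csInf_le ⟨w, fun _ hy => hy.2⟩ ⟨hv, hwv⟩) (le_csSup ⟨w, fun _ hy => hy.2⟩ ⟨hu, huw⟩)

theorem le_gapLength (hK : IsClosed K) (hb : ¬ BddBelow K) (ha : ¬ BddAbove K)
    {u v w : ℝ} (h : ∀ k ∈ K, ¬ (u < k ∧ k < v)) (huw : u < w) (hwv : w < v) :
    v - u ≤ gapLength K w := by
  obtain ⟨h1, h2⟩ := sInf_inter_Ici_mem hK ha w
  obtain ⟨h3, h4⟩ := sSup_inter_Iic_mem hK hb w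
  refine sub_le_sub ?_ ?_
  · by_contra! h'
    exact h _ h1 ⟨huw.trans_le h2, h'⟩
  · by_contra! h'
    exact h _ h3 ⟨h', lt_of_le_of_lt h4 hwv⟩

theorem gapLength_pos (hK : IsClosed K) (hb : ¬ BddBelow K) (ha : ¬ BddAbove K)
    {w : ℝ} (hw : w ∉ K) : 0 < gapLength K w := by
  obtain ⟨h1, h2⟩ := sInf_inter_Ici_mem hK ha w
  obtain ⟨h3, h4⟩ := sSup_inter_Iic_mem hK hb w
  have h5 : w ≠ sInf (K ∩ Ici w) := fun h => hw (h ▸ h1)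
  have h6 := lt_of_le_of_ne h2 h5
  simp only [mem_Iic] at h4
  unfold gapLength
  linarith

/-- The ends of the gap around `w` are mapped to points of `K` that still enclose `f w`, by
monotonicity, and are closer together, by contraction. -/
theorem gapLength_map_lt (hK : IsClosed K) (hb : ¬ BddBelow K) (ha : ¬ BddAbove K)
    {f : ℝ → ℝ} (hf : StrictlyContracting f) (mf : StrictMono f ∨ StrictAnti f)
    (hm : MapsTo f K K) {w : ℝ} (hw : 0 < gapLength K w) :
    gapLength K (f w) < gapLength K w := by
  obtain ⟨h1, h2⟩ := sInf_inter_Ici_mem hK ha w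
  obtain ⟨h3, h4⟩ := sSup_inter_Iic_mem hK hb w
  have hlt := hf _ _ (sub_pos.1 hw)
  rcases mf with mf | mf
  · exact (gapLength_le (hm h3) (hm h1) (mf.monotone h4) (mf.monotone h2)).trans_lt
      ((le_abs_self _).trans_lt hlt)
  · refine (gapLength_le (hm h1) (hm h3) (mf.antitone h2) (mf.antitone h4)).trans_lt
      (lt_of_le_of_lt ?_ hlt)
    rw [abs_sub_comm]
    exact le_abs_self _

theorem gapLength_map_le (hK : IsClosed K) (hb : ¬ BddBelow K) (ha : ¬ BddAbove K)
    {f : ℝ → ℝ} (hf : StrictlyContracting f) (mf : StrictMono f ∨ StrictAnti f)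
    (hm : MapsTo f K K) (w : ℝ) : gapLength K (f w) ≤ gapLength K w := by
  by_cases hw : w ∈ K
  · calc gapLength K (f w) ≤ f w - f w := gapLength_le (hm hw) (hm hw) le_rfl le_rfl
      _ = 0 := sub_self _
      _ ≤ gapLength K w := by
        obtain ⟨-, h2⟩ := sInf_inter_Ici_mem hK ha w
        obtain ⟨-, h4⟩ := sSup_inter_Iic_mem hK hb w
        exact sub_nonneg.2 (le_trans h4 h2)
  · exact (gapLength_map_lt hK hb ha hf mf hm (gapLength_pos hK hb ha hw)).le

/-- Gaps strictly grow under preimages, so none exists if every gap can be brought back to a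
fixed compact interval. -/
theorem eq_univ_of_mapsTo_of_recurrent (hK : IsClosed K) (hb : ¬ BddBelow K) (ha : ¬ BddAbove K)
    {f g : ℝ → ℝ} (hf : StrictlyContracting f)
    (hg : StrictlyContracting g) (mf : StrictMono f ∨ StrictAnti f)
    (mg : StrictMono g ∨ StrictAnti g) (hd : Dense (range f ∪ range g))
    (hfK : MapsTo f K K) (hgK : MapsTo g K K) {c d : ℝ}
    (hrec : ∀ l : ℝ → ℝ, (∀ w, l (f w) ≤ l w) → (∀ w, l (g w) ≤ l w) →
      ∀ w, ∃ w' ∈ Icc c d, l w ≤ l w') : K = univ := by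
  by_contra hne
  obtain ⟨p, hp⟩ := (ne_univ_iff_exists_notMem K).1 hne
  have hfl := gapLength_map_le hK hb ha hf mf hfK
  have hgl := gapLength_map_le hK hb ha hg mg hgK
  have hrec := hrec _ hfl hgl
  set c' := sSup (K ∩ Iic c)
  set d' := sInf (K ∩ Ici d)
  obtain ⟨hc1, hc2⟩ := sSup_inter_Iic_mem hK hb c
  obtain ⟨hd1, hd2⟩ := sInf_inter_Ici_mem hK ha d
  -- `P` is compact and contains the pair of ends of the gap around every point of `[c, d]`, so the
  -- length `v - u` attains a maximum on it.
  let P : Set (ℝ × ℝ) := (Icc c' d' ×ˢ Icc c' d') ∩ {q | ∀ k ∈ K, ¬ (q.1 < k ∧ k < q.2)}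
  have hPclosed : IsClosed {q : ℝ × ℝ | ∀ k ∈ K, ¬ (q.1 < k ∧ k < q.2)} := by
    have : {q : ℝ × ℝ | ∀ k ∈ K, ¬ (q.1 < k ∧ k < q.2)} =
        ⋂ k ∈ K, ({q : ℝ × ℝ | q.1 < k} ∩ {q | k < q.2})ᶜ := by
      ext q
      simp
    rw [this]
    exact isClosed_biInter fun k _ => ((isOpen_lt continuous_fst continuous_const).inter
      (isOpen_lt continuous_const continuous_snd)).isClosed_compl
  have hPc : IsCompact P := (isCompact_Icc.prod isCompact_Icc).inter_right hPclosed
  have hmem : ∀ w ∈ Icc c d, (sSup (K ∩ Iic w), sInf (K ∩ Ici w)) ∈ P := by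
    rintro w ⟨hcw, hwd⟩
    obtain ⟨h1, h2⟩ := sInf_inter_Ici_mem hK ha w
    obtain ⟨h3, h4⟩ := sSup_inter_Iic_mem hK hb w
    have h5 : c' ≤ sSup (K ∩ Iic w) := le_csSup ⟨w, fun _ hy => hy.2⟩ ⟨hc1, le_trans hc2 hcw⟩
    have h6 : sInf (K ∩ Ici w) ≤ d' := csInf_le ⟨w, fun _ hy => hy.2⟩ ⟨hd1, le_trans hwd hd2⟩
    simp only [mem_Ici, mem_Iic] at h2 h4
    refine ⟨⟨⟨h5, by linarith⟩, ⟨by linarith, h6⟩⟩, fun k hk hk' => ?_⟩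
    rcases le_total k w with h | h
    · exact hk'.1.not_ge (le_csSup ⟨w, fun _ hy => hy.2⟩ ⟨hk, h⟩)
    · exact hk'.2.not_ge (csInf_le ⟨w, fun _ hy => hy.2⟩ ⟨hk, h⟩)
  obtain ⟨p', hp', hpp'⟩ := hrec p
  obtain ⟨⟨u, v⟩, huv, hmax⟩ := hPc.exists_isMaxOn ⟨_, hmem p' hp'⟩
    (f := fun q : ℝ × ℝ => q.2 - q.1) (by fun_prop)
  have hle : ∀ w ∈ Icc c d, gapLength K w ≤ v - u := fun w hw => hmax (hmem w hw)
  have huv' : u < v := by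
    have := gapLength_pos hK hb ha hp
    have := hle p' hp'
    linarith
  -- Density puts an image point inside the maximal pair. Its preimage has a longer gap, which
  -- `hrec` brings back to `[c, d]`, against maximality.
  obtain ⟨w, ⟨hw1, hw2⟩, hw⟩ := hd.exists_mem_open isOpen_Ioo (nonempty_Ioo.2 huv') |>.imp
    fun w h => And.symm h
  have hwl := le_gapLength hK hb ha huv.2 hw1 hw2
  have key : ∃ w', gapLength K w < gapLength K w' := by
    rcases hw with ⟨w', rfl⟩ | ⟨w', rfl⟩
    · exact ⟨w', gapLength_map_lt hK hb ha hf mf hfK (by linarith [hfl w'])⟩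
    · exact ⟨w', gapLength_map_lt hK hb ha hg mg hgK (by linarith [hgl w'])⟩
  obtain ⟨w', hw'⟩ := key
  obtain ⟨w'', hw'', h⟩ := hrec w'
  linarith [hle w'' hw'']

end Gap

/-! ### The dynamical condition on the line -/

/-- `f` pushes all points towards one end of the line and `g` towards the other. -/
def PushesApart (f g : ℝ → ℝ) : Prop :=
  ((∀ y, f y < y) ∧ ∀ y, y < g y) ∨ ((∀ y, y < f y) ∧ ∀ y, g y < y)

/-- `f` pushes all points towards the same end of the line. -/
def PushesToEnd (f : ℝ → ℝ) : Prop := (∀ y, f y < y) ∨ ∀ y, y < f y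

/-- The dynamical condition for self-maps of the line whose attracting points lie at infinity. -/
def LineDynamicalCondition (f g : ℝ → ℝ) : Prop :=
  (StrictMono f ∧ StrictMono g ∧ PushesApart f g) ∨
  ((StrictMono f ∧ StrictAnti g ∧ PushesToEnd f) ∨
    (StrictMono g ∧ StrictAnti f ∧ PushesToEnd g)) ∨
  (StrictAnti f ∧ StrictAnti g ∧ PushesApart (f ∘ g) (g ∘ f))

theorem PushesApart.symm {f g : ℝ → ℝ} (h : PushesApart f g) : PushesApart g f := by
  unfold PushesApart at *
  tauto

theorem LineDynamicalCondition.symm {f g : ℝ → ℝ} (h : LineDynamicalCondition f g) :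
    LineDynamicalCondition g f := by
  have := @PushesApart.symm
  unfold LineDynamicalCondition at *
  rcases h with ⟨a, b, c⟩ | h | ⟨a, b, c⟩
  · exact Or.inl ⟨b, a, c.symm⟩
  · exact Or.inr (Or.inl h.symm)
  · exact Or.inr (Or.inr ⟨b, a, c.symm⟩)

theorem not_bdd_union_of_dense {s : Set ℝ} (hs : Dense s) : ¬ BddAbove s ∧ ¬ BddBelow s := by
  constructor
  · intro h
    have := h.closure
    rw [hs.closure_eq] at this
    exact not_bddAbove_univ this
  · intro h
    have := h.closure
    rw [hs.closure_eq] at this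
    exact not_bddBelow_univ this

theorem surjective_of_not_bdd {f : ℝ → ℝ} (hf : Continuous f) (ha : ¬ BddAbove (range f))
    (hb : ¬ BddBelow (range f)) : Function.Surjective f := by
  intro y
  obtain ⟨_, ⟨u, rfl⟩, hu⟩ := not_bddAbove_iff.1 ha y
  obtain ⟨_, ⟨v, rfl⟩, hv⟩ := not_bddBelow_iff.1 hb y
  exact mem_range_of_exists_le_of_exists_ge hf ⟨v, hv.le⟩ ⟨u, hu.le⟩

/-- If the ranges of two continuous non-surjective maps cover a dense set, then each of the two
maps covers a neighbourhood of exactly one end of the line. -/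
theorem bdd_range_of_dense {f g : ℝ → ℝ} (hf : Continuous f) (hg : Continuous g)
    (hf' : ¬ Function.Surjective f) (hg' : ¬ Function.Surjective g)
    (hd : Dense (range f ∪ range g)) :
    (BddAbove (range f) ∧ ¬ BddBelow (range f) ∧ BddBelow (range g) ∧ ¬ BddAbove (range g)) ∨
    (BddAbove (range g) ∧ ¬ BddBelow (range g) ∧ BddBelow (range f) ∧ ¬ BddAbove (range f)) := by
  have h2 := surjective_of_not_bdd hg
  obtain ⟨h3, h4⟩ := not_bdd_union_of_dense hd
  rw [bddAbove_union] at h3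
  rw [bddBelow_union] at h4
  have h1 := surjective_of_not_bdd hf
  tauto

theorem StrictAnti.exists_gt_of_not_bddAbove {g : ℝ → ℝ} (mg : StrictAnti g)
    (h : ¬ BddAbove (range g)) (M : ℝ) : ∃ m, ∀ y ≤ m, M < g y := by
  obtain ⟨_, ⟨m, rfl⟩, hm⟩ := not_bddAbove_iff.1 h M
  exact ⟨m, fun y hy => hm.trans_le (mg.antitone hy)⟩

/-! ### Minimality under the dynamical condition -/

section Minimality

variable {f g : ℝ → ℝ} {K : Set ℝ}

/-- The fundamental domains `[F 0, 0]` and `[0, G 0]` serve the two half-lines. In the decreasing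
case `F` and `G` are the two compositions. -/
theorem recurrent_of_pushesApart {F G : ℝ → ℝ} (hF : Continuous F) (hG : Continuous G)
    (h : PushesApart F G) : ∃ c d : ℝ, ∀ l : ℝ → ℝ, (∀ w, l (F w) ≤ l w) → (∀ w, l (G w) ≤ l w) →
      ∀ w, ∃ w' ∈ Icc c d, l w ≤ l w' := by
  wlog h' : (∀ y, F y < y) ∧ ∀ y, y < G y generalizing F G
  · obtain ⟨c, d, hcd⟩ := this hG hF h.symm (by unfold PushesApart at h; tauto)
    exact ⟨c, d, fun l h1 h2 => hcd l h2 h1⟩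
  refine ⟨F 0, G 0, fun l h1 h2 w => ?_⟩
  rcases le_total w 0 with hw | hw
  · obtain ⟨w', hw', hl⟩ := exists_mem_Icc_le_of_lt hF h'.1 h1 hw
    exact ⟨w', ⟨hw'.1, hw'.2.trans (h'.2 0).le⟩, hl⟩
  · obtain ⟨w', hw', hl⟩ := exists_mem_Icc_le_of_gt hG h'.2 h2 hw
    exact ⟨w', ⟨(h'.1 0).le.trans hw'.1, hw'.2⟩, hl⟩

theorem not_bdd_of_pushesApart {F G : ℝ → ℝ} (h : PushesApart F G) (hK : IsClosed K)
    (hne : K.Nonempty) (hF : MapsTo F K K) (hG : MapsTo G K K) : ¬ BddBelow K ∧ ¬ BddAbove K := by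
  rcases h with h | h
  · exact ⟨not_bddBelow_of_mapsTo h.1 hK hne hF, not_bddAbove_of_mapsTo h.2 hK hne hG⟩
  · exact ⟨not_bddBelow_of_mapsTo h.2 hK hne hG, not_bddAbove_of_mapsTo h.1 hK hne hF⟩

/-- Having bounded range above, `f` can only push to the left, which settles the left half-line. A
point to the right of `g 0` is a value `g v` with `v ≤ 0`, so one pullback by `g` reduces it to that
case. -/
theorem recurrent_of_pushesToEnd (hf : Continuous f) (hg : Continuous g)
    (mg : StrictAnti g) (hfb : BddAbove (range f)) (hga : ¬ BddAbove (range g))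
    (h : PushesToEnd f) : ∃ c d : ℝ, ∀ l : ℝ → ℝ, (∀ w, l (f w) ≤ l w) → (∀ w, l (g w) ≤ l w) →
      ∀ w, ∃ w' ∈ Icc c d, l w ≤ l w' := by
  have hlt : ∀ y, f y < y := by
    refine h.resolve_right fun h => ?_
    obtain ⟨M, hM⟩ := hfb
    exact (h M).not_ge (hM ⟨M, rfl⟩)
  refine ⟨f 0, max 0 (g 0), fun l h1 h2 w => ?_⟩
  have key : ∀ w ≤ 0, ∃ w' ∈ Icc (f 0) (max 0 (g 0)), l w ≤ l w' := fun w hw => by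
    obtain ⟨w', hw', hl⟩ := exists_mem_Icc_le_of_lt hf hlt h1 hw
    exact ⟨w', ⟨hw'.1, hw'.2.trans (le_max_left _ _)⟩, hl⟩
  rcases le_total w 0 with hw | hw
  · exact key w hw
  rcases le_total w (g 0) with hw' | hw'
  · exact ⟨w, ⟨(hlt 0).le.trans hw, hw'.trans (le_max_right _ _)⟩, le_rfl⟩
  obtain ⟨m, hm⟩ := mg.exists_gt_of_not_bddAbove hga w
  obtain ⟨v, rfl⟩ := mem_range_of_exists_le_of_exists_ge hg ⟨0, hw'⟩ ⟨m, (hm m le_rfl).le⟩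
  obtain ⟨w', hw', hl⟩ := key v (mg.le_iff_ge.1 hw')
  exact ⟨w', hw', (h2 v).trans hl⟩

/-- The map `f` makes `K` unbounded below, and the decreasing `g` carries points of `K` far to the
left to points far to the right. -/
theorem not_bdd_of_pushesToEnd (mg : StrictAnti g) (hfb : BddAbove (range f))
    (hga : ¬ BddAbove (range g)) (h : PushesToEnd f) (hK : IsClosed K)
    (hne : K.Nonempty) (hfK : MapsTo f K K) (hgK : MapsTo g K K) :
    ¬ BddBelow K ∧ ¬ BddAbove K := by
  have hlt : ∀ y, f y < y := by
    refine h.resolve_right fun h => ?_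
    obtain ⟨M, hM⟩ := hfb
    exact (h M).not_ge (hM ⟨M, rfl⟩)
  have hb := not_bddBelow_of_mapsTo hlt hK hne hfK
  refine ⟨hb, not_bddAbove_iff.2 fun M => ?_⟩
  obtain ⟨m, hm⟩ := mg.exists_gt_of_not_bddAbove hga M
  obtain ⟨k, hk, hkm⟩ := not_bddBelow_iff.1 hb m
  exact ⟨g k, hgK hk, hm k hkm.le⟩

/-- The conjugate of `f` by the reflection of the line. -/
def reflect (f : ℝ → ℝ) : ℝ → ℝ := fun x => -f (-x)

theorem range_reflect (f : ℝ → ℝ) : range (reflect f) = -range f := by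
  ext y
  constructor
  · rintro ⟨x, rfl⟩
    exact ⟨-x, by simp [reflect]⟩
  · rintro ⟨x, hx⟩
    exact ⟨-x, by simp [reflect, hx]⟩

theorem reflect_reflect (f : ℝ → ℝ) : reflect (reflect f) = f := by
  ext; simp [reflect]

theorem reflect_comp (f g : ℝ → ℝ) : reflect f ∘ reflect g = reflect (f ∘ g) := by
  ext; simp [reflect]

theorem StrictMono.reflect (h : StrictMono f) : StrictMono (reflect f) := fun _ _ hxy =>
  neg_lt_neg (h (neg_lt_neg hxy))

theorem StrictAnti.reflect (h : StrictAnti f) : StrictAnti (reflect f) := fun _ _ hxy =>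
  neg_lt_neg (h (neg_lt_neg hxy))

theorem StrictlyContracting.reflect (h : StrictlyContracting f) : StrictlyContracting (reflect f) :=
  h.neg_conj

theorem PushesToEnd.reflect (h : PushesToEnd f) : PushesToEnd (reflect f) :=
  h.symm.imp (fun h y => by have := h (-y); simp only [_root_.reflect]; linarith)
    (fun h y => by have := h (-y); simp only [_root_.reflect]; linarith)

theorem PushesApart.reflect (h : PushesApart f g) : PushesApart (reflect f) (reflect g) := by
  rcases h with ⟨h1, h2⟩ | ⟨h1, h2⟩
  · refine Or.inr ⟨fun y => ?_, fun y => ?_⟩ <;> simp only [_root_.reflect]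
    · linarith [h1 (-y)]
    · linarith [h2 (-y)]
  · refine Or.inl ⟨fun y => ?_, fun y => ?_⟩ <;> simp only [_root_.reflect]
    · linarith [h1 (-y)]
    · linarith [h2 (-y)]

theorem Set.MapsTo.reflect (h : MapsTo f K K) : MapsTo (reflect f) (-K) (-K) := fun x hx => by
  simpa [_root_.reflect] using h hx

theorem dense_neg_iff {s : Set ℝ} : Dense (-s) ↔ Dense s := by
  have key : ∀ s : Set ℝ, Dense s → Dense (-s) := fun s hs =>
    hs.preimage (Homeomorph.neg ℝ).isOpenMap
  exact ⟨fun h => by simpa using key _ h, key s⟩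

theorem dense_range_reflect (hd : Dense (range f ∪ range g)) :
    Dense (range (reflect f) ∪ range (reflect g)) := by
  rw [range_reflect, range_reflect, ← Set.union_neg]
  exact dense_neg_iff.2 hd

theorem LineDynamicalCondition.reflect (h : LineDynamicalCondition f g) :
    LineDynamicalCondition (reflect f) (reflect g) := by
  rcases h with ⟨a, b, c⟩ | (⟨a, b, c⟩ | ⟨a, b, c⟩) | ⟨a, b, c⟩
  · exact Or.inl ⟨a.reflect, b.reflect, c.reflect⟩
  · exact Or.inr (Or.inl (Or.inl ⟨a.reflect, b.reflect, c.reflect⟩))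
  · exact Or.inr (Or.inl (Or.inr ⟨a.reflect, b.reflect, c.reflect⟩))
  · refine Or.inr (Or.inr ⟨a.reflect, b.reflect, ?_⟩)
    rw [reflect_comp, reflect_comp]
    exact c.reflect

theorem eq_univ_of_mapsTo (hf : StrictlyContracting f) (hg : StrictlyContracting g)
    (hf' : ¬ Function.Surjective f) (hg' : ¬ Function.Surjective g)
    (hd : Dense (range f ∪ range g)) (h : LineDynamicalCondition f g)
    (hK : IsClosed K) (hne : K.Nonempty) (hfK : MapsTo f K K) (hgK : MapsTo g K K) :
    K = univ := by
  wlog hb : BddAbove (range f) ∧ ¬ BddBelow (range f) ∧ BddBelow (range g) ∧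
      ¬ BddAbove (range g) generalizing f g
  · exact this hg hf hg' hf' (union_comm _ _ ▸ hd) h.symm hgK hfK
      ((bdd_range_of_dense hf.continuous hg.continuous hf' hg' hd).resolve_left hb)
  obtain ⟨hb1, hb2, hb3, hb4⟩ := hb
  rcases h with ⟨mf, mg, h⟩ | (⟨mf, mg, h⟩ | ⟨mg, mf, h⟩) | ⟨mf, mg, h⟩
  · obtain ⟨c, d, hrec⟩ := recurrent_of_pushesApart hf.continuous hg.continuous h
    obtain ⟨kb, ka⟩ := not_bdd_of_pushesApart h hK hne hfK hgK
    exact eq_univ_of_mapsTo_of_recurrent hK kb ka hf hg (.inl mf) (.inl mg) hd hfK hgK hrec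
  · obtain ⟨c, d, hrec⟩ := recurrent_of_pushesToEnd hf.continuous hg.continuous mg hb1 hb4 h
    obtain ⟨kb, ka⟩ := not_bdd_of_pushesToEnd mg hb1 hb4 h hK hne hfK hgK
    exact eq_univ_of_mapsTo_of_recurrent hK kb ka hf hg (.inl mf) (.inr mg) hd hfK hgK hrec
  -- Here the increasing map is the one whose range is bounded below; reflecting the line reduces to
  -- the previous case.
  · have hb3' : BddAbove (range (reflect g)) := by rw [range_reflect]; exact hb3.neg
    have hb2' : ¬ BddAbove (range (reflect f)) := by
      rw [range_reflect, bddAbove_neg]; exact hb2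
    have hne' : (-K).Nonempty := hne.neg
    obtain ⟨c, d, hrec⟩ := recurrent_of_pushesToEnd hg.reflect.continuous hf.reflect.continuous
      mf.reflect hb3' hb2' h.reflect
    obtain ⟨kb, ka⟩ := not_bdd_of_pushesToEnd mf.reflect hb3' hb2' h.reflect hK.neg hne'
      hgK.reflect hfK.reflect
    have := eq_univ_of_mapsTo_of_recurrent hK.neg kb ka hg.reflect hf.reflect (.inl mg.reflect)
      (.inr mf.reflect) (dense_range_reflect (union_comm _ _ ▸ hd)) hgK.reflect
      hfK.reflect hrec
    rwa [neg_eq_iff_eq_neg, Set.neg_univ] at this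
  · obtain ⟨c, d, hrec⟩ := recurrent_of_pushesApart (hf.continuous.comp hg.continuous)
      (hg.continuous.comp hf.continuous) h
    obtain ⟨kb, ka⟩ := not_bdd_of_pushesApart h hK hne (hfK.comp hgK) (hgK.comp hfK)
    exact eq_univ_of_mapsTo_of_recurrent hK kb ka hf hg (.inr mf) (.inr mg) hd hfK hgK
      fun l h1 h2 => hrec l (fun w => (h1 _).trans (h2 w)) (fun w => (h2 _).trans (h1 w))

theorem dense_of_mapsTo (hf : StrictlyContracting f) (hg : StrictlyContracting g)
    (hf' : ¬ Function.Surjective f) (hg' : ¬ Function.Surjective g)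
    (hd : Dense (range f ∪ range g)) (h : LineDynamicalCondition f g)
    (hne : K.Nonempty) (hfK : MapsTo f K K) (hgK : MapsTo g K K) : Dense K :=
  dense_iff_closure_eq.2 (eq_univ_of_mapsTo hf hg hf' hg' hd h isClosed_closure
    hne.closure (hfK.closure hf.continuous) (hgK.closure hg.continuous))

end Minimality

/-! ### Invariant traps when the dynamical condition fails -/

section Trapping

variable {f g : ℝ → ℝ}

theorem mapsTo_Ici_of_le {F : ℝ → ℝ} (mF : StrictMono F) {y : ℝ} (h : y ≤ F y) :
    MapsTo F (Ici y) (Ici y) := fun _ hz => h.trans (mF.monotone hz)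

/-- If `f` does not move `y` to the left, it moves no point to the left of `y` that way either. So
`[m, ∞)` is invariant once `m` is below `y`, the range of `g` and `X`. -/
theorem exists_mapsTo_of_mono (hf : StrictlyContracting f) (mf : StrictMono f)
    (hgb : BddBelow (range g)) (h : ¬ ∀ y, f y < y) {X : Set ℝ} (hX : BddBelow X) :
    ∃ J : Set ℝ, X ⊆ J ∧ MapsTo f J J ∧ MapsTo g J J ∧ ¬ Dense J := by
  push Not at h
  obtain ⟨y, hy⟩ := h
  obtain ⟨e, he⟩ := hgb
  obtain ⟨x, hx⟩ := hX
  let m := min y (min e x)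
  have hm1 : m ≤ y := min_le_left _ _
  have hm2 : m ≤ e := (min_le_right _ _).trans (min_le_left _ _)
  have hm3 : m ≤ x := (min_le_right _ _).trans (min_le_right _ _)
  refine ⟨Ici m, fun z hz => hm3.trans (hx hz), mapsTo_Ici_of_le mf (hf.le_of_le hy hm1),
    fun z _ => hm2.trans (he ⟨z, rfl⟩), fun hd => (not_bdd_union_of_dense hd).2 bddBelow_Ici⟩

/-- The trap is `[m, g m]` with `m` far to the left. The delicate bound is `m ≤ f (g m)`, which
holds because the contraction `f ∘ g` does not move `y` to the left and `m ≤ y`. -/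
theorem exists_mapsTo_of_anti (hf : StrictlyContracting f) (hg : StrictlyContracting g)
    (mf : StrictAnti f) (mg : StrictAnti g) (hfb : BddAbove (range f)) (hgb : BddBelow (range g))
    (hga : ¬ BddAbove (range g)) (h : ¬ ∀ y, f (g y) < y) {X : Set ℝ} (hX : BddBelow X)
    (hX' : BddAbove X) :
    ∃ J : Set ℝ, X ⊆ J ∧ MapsTo f J J ∧ MapsTo g J J ∧ ¬ Dense J := by
  push Not at h
  obtain ⟨y, hy⟩ := h
  obtain ⟨e, he⟩ := hgb
  obtain ⟨e', he'⟩ := hfb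
  obtain ⟨x, hx⟩ := hX
  obtain ⟨x', hx'⟩ := hX'
  -- Below `p`, the values of `g` exceed both the range of `f` and the set `X`.
  obtain ⟨p, hp⟩ := mg.exists_gt_of_not_bddAbove hga (max e' x')
  let m := min (min y p) (min e x)
  have hm1 : m ≤ y := (min_le_left _ _).trans (min_le_left _ _)
  have hm4 : m ≤ p := (min_le_left _ _).trans (min_le_right _ _)
  have hm2 : m ≤ e := (min_le_right _ _).trans (min_le_left _ _)
  have hm3 : m ≤ x := (min_le_right _ _).trans (min_le_right _ _)
  have hgm := hp m hm4
  refine ⟨Icc m (g m), fun z hz => ⟨hm3.trans (hx hz),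
    (hx' hz).trans ((le_max_right _ _).trans hgm.le)⟩, fun z hz => ⟨?_, ?_⟩, fun z hz => ⟨?_, ?_⟩,
    fun hd => (not_bdd_union_of_dense hd).2 bddBelow_Icc⟩
  · exact ((hf.comp hg).le_of_le hy hm1).trans (mf.antitone hz.2)
  · exact (he' ⟨z, rfl⟩).trans ((le_max_left _ _).trans hgm.le)
  · exact hm2.trans (he ⟨z, rfl⟩)
  · exact mg.antitone hz.1

theorem exists_mapsTo_of_reflect {X : Set ℝ}
    (h : ∃ J : Set ℝ, -X ⊆ J ∧ MapsTo (reflect f) J J ∧ MapsTo (reflect g) J J ∧ ¬ Dense J) :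
    ∃ J : Set ℝ, X ⊆ J ∧ MapsTo f J J ∧ MapsTo g J J ∧ ¬ Dense J := by
  obtain ⟨J, h1, h2, h3, h4⟩ := h
  refine ⟨-J, Set.neg_subset.1 h1, ?_, ?_, fun h => h4 (dense_neg_iff.1 h)⟩
  · simpa only [reflect_reflect] using h2.reflect
  · simpa only [reflect_reflect] using h3.reflect

/-- Without the dynamical condition every bounded set lies in an invariant set that is not
dense. -/
theorem exists_mapsTo_of_not_lineDynamicalCondition (hf : StrictlyContracting f)
    (hg : StrictlyContracting g) (hf' : ¬ Function.Surjective f) (hg' : ¬ Function.Surjective g)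
    (mf : StrictMono f ∨ StrictAnti f) (mg : StrictMono g ∨ StrictAnti g)
    (hd : Dense (range f ∪ range g)) (h : ¬ LineDynamicalCondition f g) {X : Set ℝ}
    (hX : BddBelow X) (hX' : BddAbove X) :
    ∃ J : Set ℝ, X ⊆ J ∧ MapsTo f J J ∧ MapsTo g J J ∧ ¬ Dense J := by
  wlog hb : BddAbove (range f) ∧ ¬ BddBelow (range f) ∧ BddBelow (range g) ∧
      ¬ BddAbove (range g) generalizing f g
  · obtain ⟨J, h1, h2, h3, h4⟩ := this hg hf hg' hf' mg mf (union_comm _ _ ▸ hd)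
      (fun h' => h h'.symm)
      ((bdd_range_of_dense hf.continuous hg.continuous hf' hg' hd).resolve_left hb)
    exact ⟨J, h1, h3, h2, h4⟩
  obtain ⟨hb1, hb2, hb3, hb4⟩ := hb
  have hb1' : BddBelow (range (reflect f)) := by rw [range_reflect]; exact hb1.neg
  have hb2' : ¬ BddAbove (range (reflect f)) := by rw [range_reflect, bddAbove_neg]; exact hb2
  have hb3' : BddAbove (range (reflect g)) := by rw [range_reflect]; exact hb3.neg
  have low : StrictMono f → (¬ ∀ y, f y < y) →
      ∃ J : Set ℝ, X ⊆ J ∧ MapsTo f J J ∧ MapsTo g J J ∧ ¬ Dense J := fun mf h =>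
    exists_mapsTo_of_mono hf mf hb3 h hX
  have high : StrictMono g → (¬ ∀ y, y < g y) →
      ∃ J : Set ℝ, X ⊆ J ∧ MapsTo f J J ∧ MapsTo g J J ∧ ¬ Dense J := fun mg h => by
    obtain ⟨J, h1, h2, h3, h4⟩ := exists_mapsTo_of_reflect <| exists_mapsTo_of_mono hg.reflect
      mg.reflect hb1' (fun h' => h fun y => by
        have := h' (-y); simp only [reflect, neg_neg] at this; linarith) hX'.neg
    exact ⟨J, h1, h3, h2, h4⟩
  -- Under the normalisation `hb`, an increasing `f` could only push left and an increasing `g` only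
  -- right; in each case one required push fails and gives a trap.
  rcases mf with mf | mf <;> rcases mg with mg | mg
  · by_cases h1 : ∀ y, f y < y
    · exact high mg fun h2 => h (Or.inl ⟨mf, mg, Or.inl ⟨h1, h2⟩⟩)
    · exact low mf h1
  · exact low mf fun h1 => h (Or.inr (Or.inl (Or.inl ⟨mf, mg, Or.inl h1⟩)))
  · exact high mg fun h1 => h (Or.inr (Or.inl (Or.inr ⟨mg, mf, Or.inr h1⟩)))
  · by_cases h1 : ∀ y, f (g y) < y
    · have h2 : ¬ ∀ y, y < g (f y) := fun h2 => h (Or.inr (Or.inr ⟨mf, mg, Or.inl ⟨h1, h2⟩⟩))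
      obtain ⟨J, h1, h2, h3, h4⟩ := exists_mapsTo_of_reflect <|
        exists_mapsTo_of_anti hg.reflect hf.reflect mg.reflect mf.reflect hb3' hb1' hb2'
          (fun h' => h2 fun y => by
            have := h' (-y); simp only [reflect, neg_neg] at this; linarith) hX'.neg hX.neg
      exact ⟨J, h1, h3, h2, h4⟩
    · exact exists_mapsTo_of_anti hf hg mf mg hb1 hb3 hb4 h1 hX hX'

end Trapping

/-! ### Möbius maps of the half-line and the Schwarz–Pick inequality -/

/-- `φ` is a Möbius map in the exponential coordinate. -/
def IsExpMobius (φ : ℝ → ℝ) : Prop :=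
  ∃ a b c d : ℝ, a * d - b * c ≠ 0 ∧
    ∀ y, c * Real.exp y + d ≠ 0 ∧ Real.exp (φ y) = (a * Real.exp y + b) / (c * Real.exp y + d)

theorem nonneg_of_forall_pos {c d : ℝ} (h : ∀ s : ℝ, 0 < s → 0 < c * s + d) : 0 ≤ c ∧ 0 ≤ d := by
  constructor
  · by_contra! hc
    have := h ((|d| + 1) / -c) (div_pos (by positivity) (by linarith))
    have e : c * ((|d| + 1) / -c) = -(|d| + 1) := by field_simp [hc.ne]
    rw [e] at this
    linarith [le_abs_self d]
  · by_contra! hd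
    have h1 : 0 < |c| + 1 := by positivity
    have := h (-d / (|c| + 1)) (div_pos (by linarith) h1)
    have h2 : c * (-d / (|c| + 1)) ≤ -d := by
      rw [mul_div_assoc', div_le_iff₀ h1]
      nlinarith [le_abs_self c]
    linarith

theorem forall_pos_or_forall_neg {c d : ℝ} (h : ∀ s : ℝ, 0 < s → c * s + d ≠ 0) :
    (∀ s : ℝ, 0 < s → 0 < c * s + d) ∨ ∀ s : ℝ, 0 < s → c * s + d < 0 := by
  have hpre : IsPreconnected (Ioi (0 : ℝ)) := isPreconnected_Ioi
  have hc : ContinuousOn (fun s : ℝ => c * s + d) (Ioi 0) := by fun_prop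
  by_contra! hcon
  obtain ⟨⟨s, hs, h1⟩, ⟨t, ht, h2⟩⟩ := hcon
  obtain ⟨r, hr, hr0⟩ := hpre.intermediate_value hs ht hc (⟨h1, h2⟩ : (0 : ℝ) ∈ Icc _ _)
  exact h r hr hr0

/-- A Möbius map that preserves the half-line can be written with non-negative coefficients. -/
theorem IsExpMobius.exists_nonneg {φ : ℝ → ℝ} (h : IsExpMobius φ) :
    ∃ a b c d : ℝ, 0 ≤ a ∧ 0 ≤ b ∧ 0 ≤ c ∧ 0 ≤ d ∧ a * d - b * c ≠ 0 ∧
      ∀ y, 0 < a * Real.exp y + b ∧ 0 < c * Real.exp y + d ∧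
        Real.exp (φ y) = (a * Real.exp y + b) / (c * Real.exp y + d) := by
  obtain ⟨a, b, c, d, hdet, h⟩ := h
  have hne : ∀ s : ℝ, 0 < s → c * s + d ≠ 0 := fun s hs => by
    have := (h (Real.log s)).1
    rwa [Real.exp_log hs] at this
  have hpos : ∀ y, 0 < (a * Real.exp y + b) / (c * Real.exp y + d) := fun y =>
    (h y).2 ▸ Real.exp_pos _
  have key : ∀ a b c d : ℝ, (∀ s : ℝ, 0 < s → 0 < c * s + d) →
      (∀ y, 0 < (a * Real.exp y + b) / (c * Real.exp y + d)) →
      0 ≤ a ∧ 0 ≤ b ∧ 0 ≤ c ∧ 0 ≤ d ∧ ∀ y, 0 < a * Real.exp y + b ∧ 0 < c * Real.exp y + d := by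
    intro a b c d hp hq
    have hn : ∀ y, 0 < a * Real.exp y + b := fun y =>
      (div_pos_iff_of_pos_right (hp _ (Real.exp_pos y))).1 (hq y)
    obtain ⟨hc, hd⟩ := nonneg_of_forall_pos hp
    obtain ⟨ha, hb⟩ := nonneg_of_forall_pos (c := a) (d := b) fun s hs => by
      have := hn (Real.log s)
      rwa [Real.exp_log hs] at this
    exact ⟨ha, hb, hc, hd, fun y => ⟨hn y, hp _ (Real.exp_pos y)⟩⟩
  rcases forall_pos_or_forall_neg hne with hp | hp
  · obtain ⟨ha, hb, hc, hd, h'⟩ := key a b c d hp hpos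
    exact ⟨a, b, c, d, ha, hb, hc, hd, hdet, fun y => ⟨(h' y).1, (h' y).2, (h y).2⟩⟩
  -- A denominator negative on the whole half-line is corrected by changing all four signs, which
  -- keeps the determinant.
  · have e : ∀ y, (-a * Real.exp y + -b) / (-c * Real.exp y + -d) =
        (a * Real.exp y + b) / (c * Real.exp y + d) := fun y => by
      rw [← neg_div_neg_eq]
      congr 1 <;> ring
    obtain ⟨ha, hb, hc, hd, h'⟩ := key (-a) (-b) (-c) (-d) (fun s hs => by linarith [hp s hs])
      fun y => by rw [e]; exact hpos y
    refine ⟨-a, -b, -c, -d, ha, hb, hc, hd, ?_, fun y => ⟨(h' y).1, (h' y).2, ?_⟩⟩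
    · convert hdet using 1
      ring
    · rw [e]
      exact (h y).2

/-- Schwarz–Pick: a Möbius map that sends the half-line into, but not onto, itself strictly
decreases logarithmic distances. -/
theorem IsExpMobius.strictlyContracting {φ : ℝ → ℝ} (h : IsExpMobius φ)
    (hs : ¬ Function.Surjective φ) : StrictlyContracting φ := by
  obtain ⟨a, b, c, d, ha, hb, hc, hd, hdet, h⟩ := h.exists_nonneg
  -- The maps with `b = c = 0` or `a = d = 0` are translations and reflections in the logarithmic
  -- coordinate; they are onto, hence excluded.
  have hlin : ¬ (b = 0 ∧ c = 0) := by
    rintro ⟨rfl, rfl⟩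
    simp only [mul_zero, sub_zero, ne_eq, mul_eq_zero, not_or] at hdet
    refine hs fun y => ⟨Real.log (d / a * Real.exp y), Real.exp_injective ?_⟩
    have had : 0 < d / a := div_pos (lt_of_le_of_ne hd (Ne.symm hdet.2))
      (lt_of_le_of_ne ha (Ne.symm hdet.1))
    rw [(h _).2.2, Real.exp_log (by positivity)]
    have := hdet.1
    have := hdet.2
    field_simp
    ring
  have hinv : ¬ (a = 0 ∧ d = 0) := by
    rintro ⟨rfl, rfl⟩
    simp only [mul_zero, zero_sub, ne_eq, neg_eq_zero, mul_eq_zero, not_or] at hdet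
    refine hs fun y => ⟨Real.log (b / c / Real.exp y), Real.exp_injective ?_⟩
    have had : 0 < b / c := div_pos (lt_of_le_of_ne hb (Ne.symm hdet.1))
      (lt_of_le_of_ne hc (Ne.symm hdet.2))
    rw [(h _).2.2, Real.exp_log (by positivity)]
    have := hdet.1
    have := hdet.2
    field_simp
    ring
  have hcases : (0 < a ∧ 0 < d) ∨ (0 < b ∧ 0 < c) := by
    rcases ha.eq_or_lt with rfl | ha
    · rcases hb.eq_or_lt with rfl | hb
      · simp at hdet
      · rcases hc.eq_or_lt with rfl | hc
        · simp at hdet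
        · exact Or.inr ⟨hb, hc⟩
    · rcases hd.eq_or_lt with rfl | hd
      · rcases hb.eq_or_lt with rfl | hb
        · simp at hdet
        · rcases hc.eq_or_lt with rfl | hc
          · simp at hdet
          · exact Or.inr ⟨hb, hc⟩
      · exact Or.inl ⟨ha, hd⟩
  -- With `s = exp u` and `t = exp v`, the bounds `φ v - φ u < v - u` and `φ u - φ v < v - u`
  -- become, after clearing denominators, positivity of `t - s` times `ac·st + bc(s + t) + bd` and
  -- `ac·st + ad(s + t) + bd` respectively. Each factor is positive once its coefficients do not all
  -- vanish.
  have hsum1 : 0 < a * c + b * c + b * d := by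
    rcases hcases with ⟨h1, h2⟩ | ⟨h1, h2⟩
    · rcases hb.eq_or_lt with rfl | hb
      · rcases hc.eq_or_lt with rfl | hc
        · simp at hlin
        · positivity
      · positivity
    · positivity
  have hsum2 : 0 < a * c + a * d + b * d := by
    rcases hcases with ⟨h1, h2⟩ | ⟨h1, h2⟩
    · positivity
    · rcases ha.eq_or_lt with rfl | ha
      · rcases hd.eq_or_lt with rfl | hd
        · simp at hinv
        · positivity
      · positivity
  have pos3 : ∀ x y z p q r : ℝ, 0 ≤ x → 0 ≤ y → 0 ≤ z → 0 < x + y + z → 0 < p → 0 < q → 0 < r →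
      0 < x * p + y * q + z * r := by
    intro x y z p q r hx hy hz h hp hq hr
    by_contra! hle
    have h1 : x * p = 0 := by nlinarith [mul_nonneg hx hp.le, mul_nonneg hy hq.le, mul_nonneg hz hr.le]
    have h2 : y * q = 0 := by nlinarith [mul_nonneg hx hp.le, mul_nonneg hy hq.le, mul_nonneg hz hr.le]
    have h3 : z * r = 0 := by nlinarith [mul_nonneg hx hp.le, mul_nonneg hy hq.le, mul_nonneg hz hr.le]
    have := (mul_eq_zero.1 h1).resolve_right hp.ne'
    have := (mul_eq_zero.1 h2).resolve_right hq.ne'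
    have := (mul_eq_zero.1 h3).resolve_right hr.ne'
    linarith
  intro u v huv
  obtain ⟨n1, m1, e1⟩ := h u
  obtain ⟨n2, m2, e2⟩ := h v
  have hst := Real.exp_lt_exp.2 huv
  have hts := sub_pos.2 hst
  have hs0 := Real.exp_pos u
  have ht0 := Real.exp_pos v
  have h1 : Real.exp (φ v + u) < Real.exp (φ u + v) := by
    rw [Real.exp_add, Real.exp_add, e1, e2]
    rw [div_mul_eq_mul_div, div_mul_eq_mul_div, div_lt_div_iff₀ m2 m1]
    have := pos3 _ _ _ (Real.exp u * Real.exp v * (Real.exp v - Real.exp u))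
      ((Real.exp v + Real.exp u) * (Real.exp v - Real.exp u)) (Real.exp v - Real.exp u)
      (mul_nonneg ha hc) (mul_nonneg hb hc) (mul_nonneg hb hd) hsum1
      (by positivity) (by positivity) hts
    linarith
  have h2 : Real.exp (φ u + u) < Real.exp (φ v + v) := by
    rw [Real.exp_add, Real.exp_add, e1, e2]
    rw [div_mul_eq_mul_div, div_mul_eq_mul_div, div_lt_div_iff₀ m1 m2]
    have := pos3 _ _ _ (Real.exp u * Real.exp v * (Real.exp v - Real.exp u))
      ((Real.exp v + Real.exp u) * (Real.exp v - Real.exp u)) (Real.exp v - Real.exp u)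
      (mul_nonneg ha hc) (mul_nonneg ha hd) (mul_nonneg hb hd) hsum2
      (by positivity) (by positivity) hts
    linarith
  rw [Real.exp_lt_exp] at h1 h2
  rw [abs_lt]
  constructor <;> linarith

/-! ### The logarithmic chart of the interval -/

/-- The interior of an interval other than the line is cut out by two affine forms whose quotient
is an increasing Möbius map onto the half-line. -/
theorem exists_affine_forms {I : Set ℝ} (hI : I.OrdConnected) (hI' : I ≠ univ)
    (hn : I.Nontrivial) : ∃ p q r s : ℝ, 0 ≤ p ∧ r ≤ 0 ∧ 0 < p * s - r * q ∧
      interior I = {x | 0 < p * x + q ∧ 0 < r * x + s} := by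
  have hIoo : ∀ a b : ℝ, a < b → ∃ p q r s : ℝ, 0 ≤ p ∧ r ≤ 0 ∧ 0 < p * s - r * q ∧
      Ioo a b = {x | 0 < p * x + q ∧ 0 < r * x + s} := fun a b hab =>
    ⟨1, -a, -1, b, zero_le_one, by norm_num, by linarith, by
      ext x; simp only [mem_Ioo, mem_ofPred_eq]; constructor <;> rintro ⟨h1, h2⟩ <;>
        constructor <;> linarith⟩
  -- An infinite end contributes the constant form `1`.
  have hIoi : ∀ a : ℝ, ∃ p q r s : ℝ, 0 ≤ p ∧ r ≤ 0 ∧ 0 < p * s - r * q ∧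
      Ioi a = {x | 0 < p * x + q ∧ 0 < r * x + s} := fun a =>
    ⟨1, -a, 0, 1, zero_le_one, le_rfl, by norm_num, by
      ext x; simp⟩
  have hIio : ∀ b : ℝ, ∃ p q r s : ℝ, 0 ≤ p ∧ r ≤ 0 ∧ 0 < p * s - r * q ∧
      Iio b = {x | 0 < p * x + q ∧ 0 < r * x + s} := fun b =>
    ⟨0, 1, -1, b, le_rfl, by norm_num, by norm_num, by
      ext x; simp⟩
  obtain ⟨a, ha, b, hb, hab⟩ := hn.exists_lt
  have hlt : BddBelow I → BddAbove I → sInf I < sSup I := fun h1 h2 =>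
    (csInf_le h1 ha).trans_lt (hab.trans_le (le_csSup h2 hb))
  have hbdd : ∀ c d, I ⊆ Icc c d → sInf I < sSup I := fun c d h =>
    hlt (bddBelow_Icc.mono h) (bddAbove_Icc.mono h)
  have hmem := hI.isPreconnected.mem_intervals
  simp only [mem_insert_iff, mem_singleton_iff] at hmem
  rcases hmem with h | h | h | h | h | h | h | h | h | h
  · rw [h, interior_Icc]
    exact hIoo _ _ (hbdd _ _ h.le)
  · rw [h, interior_Ico]
    exact hIoo _ _ (hbdd _ _ (h.le.trans Ico_subset_Icc_self))
  · rw [h, interior_Ioc]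
    exact hIoo _ _ (hbdd _ _ (h.le.trans Ioc_subset_Icc_self))
  · rw [h, interior_Ioo]
    exact hIoo _ _ (hbdd _ _ (h.le.trans Ioo_subset_Icc_self))
  · rw [h, interior_Ici]
    exact hIoi _
  · rw [h, interior_Ioi]
    exact hIoi _
  · rw [h, interior_Iic]
    exact hIio _
  · rw [h, interior_Iio]
    exact hIio _
  · exact absurd h hI'
  · exact absurd ha (h ▸ notMem_empty a)

/-- `e` identifies the line with the interval `I` without its end points. -/
structure IsLineChart {I : Set ℝ} (e : ℝ → I) : Prop where
  strictMono : StrictMono e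
  isOpenEmbedding : IsOpenEmbedding e
  denseRange : DenseRange e
  trichotomy : ∀ z, (∀ s, z < e s) ∨ (∃ s, e s = z) ∨ (∀ s, e s < z)
  eq_of_lt : ∀ z z', (∀ s, z < e s) → (∀ s, z' < e s) → z = z'
  eq_of_gt : ∀ z z', (∀ s, e s < z) → (∀ s, e s < z') → z = z'

theorem isLineChart_of_range_eq_interior {I : Set ℝ} (hI : I.OrdConnected)
    {e : ℝ → I} (he : StrictMono e) (hr : range (fun y => (e y : ℝ)) = interior I) :
    IsLineChart e := by
  have hr' : range e = Subtype.val ⁻¹' interior I := by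
    ext z
    rw [← hr]
    simp [Subtype.ext_iff]
  have hio : OrdConnected (interior I) := hI.interior
  have hroc : OrdConnected (range e) := by
    rw [hr']
    exact hio.preimage_mono (Subtype.mono_coe _)
  -- Two distinct points of `I` always enclose an interior point, so at most one point of `I` lies
  -- on each side of the image of `e`.
  have hIoo : ∀ z z' : I, z < z' → ∃ s, z < e s ∧ e s < z' := fun z z' hz => by
    obtain ⟨m, hm1, hm2⟩ := exists_between (show (z : ℝ) < z' from hz)
    have hm : m ∈ interior I := interior_maximal
      (Ioo_subset_Icc_self.trans (hI.out z.2 z'.2)) isOpen_Ioo ⟨hm1, hm2⟩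
    rw [← hr] at hm
    obtain ⟨s, rfl⟩ := hm
    exact ⟨s, hm1, hm2⟩
  refine ⟨he, ⟨he.isEmbedding_of_ordConnected hroc, hr' ▸ isOpen_interior.preimage
    continuous_subtype_val⟩, ?_, fun z => ?_, fun z z' hz hz' => ?_, fun z z' hz hz' => ?_⟩
  · rw [DenseRange, Subtype.dense_iff, ← range_comp]
    have hne : (interior I).Nonempty := hr ▸ range_nonempty _
    change I ⊆ closure (range fun y => (e y : ℝ))
    rw [hr, (hI.convex (𝕜 := ℝ)).closure_interior_eq_closure_of_nonempty_interior hne]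
    exact subset_closure
  · by_cases hz : z ∈ range e
    · exact Or.inr (Or.inl hz)
    by_cases h : ∃ s, e s ≤ z
    · obtain ⟨s, hs⟩ := h
      refine Or.inr (Or.inr fun t => ?_)
      by_contra! ht
      exact hz (hroc.out ⟨s, rfl⟩ ⟨t, rfl⟩ ⟨hs, ht⟩)
    · push Not at h
      exact Or.inl h
  · rcases lt_trichotomy z z' with h | h | h
    · obtain ⟨s, -, hs⟩ := hIoo _ _ h
      exact absurd hs (hz' s).not_gt
    · exact h
    · obtain ⟨s, -, hs⟩ := hIoo _ _ h
      exact absurd hs (hz s).not_gt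
  · rcases lt_trichotomy z z' with h | h | h
    · obtain ⟨s, hs, -⟩ := hIoo _ _ h
      exact absurd hs (hz s).not_gt
    · exact h
    · obtain ⟨s, hs, -⟩ := hIoo _ _ h
      exact absurd hs (hz' s).not_gt

/-- Every interval other than the line has a chart in which Möbius maps stay Möbius in the
exponential coordinate. -/
theorem exists_isLineChart {I : Set ℝ} (hI : I.OrdConnected) (hI' : I ≠ univ)
    (hn : I.Nontrivial) : ∃ e : ℝ → I, IsLineChart e ∧
      ∀ f : I → I, IsMobius f → ∀ φ : ℝ → ℝ, (∀ y, f (e y) = e (φ y)) → IsExpMobius φ := by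
  obtain ⟨p, q, r, s, hp, hr, hdet, hint⟩ := exists_affine_forms hI hI' hn
  have hden : ∀ y, 0 < p - Real.exp y * r := fun y => by
    have h0 := Real.exp_pos y
    rcases hp.eq_or_lt with rfl | hp
    · rcases hr.eq_or_lt with rfl | hr
      · simp at hdet
      · nlinarith
    · nlinarith
  -- This solves `exp y = (p x + q) / (r x + s)` for `x`.
  let E : ℝ → ℝ := fun y => (Real.exp y * s - q) / (p - Real.exp y * r)
  have hEden : ∀ y, E y * (p - Real.exp y * r) = Real.exp y * s - q := fun y =>
    div_mul_cancel₀ _ (hden y).ne'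
  have h1 : ∀ y, p * E y + q = Real.exp y * (p * s - r * q) / (p - Real.exp y * r) := fun y => by
    rw [eq_div_iff (hden y).ne']
    linear_combination p * hEden y
  have h2 : ∀ y, r * E y + s = (p * s - r * q) / (p - Real.exp y * r) := fun y => by
    rw [eq_div_iff (hden y).ne']
    linear_combination r * hEden y
  have hE : ∀ y, E y ∈ interior I := fun y => by
    rw [hint]
    constructor
    · rw [h1]
      exact div_pos (mul_pos (Real.exp_pos y) hdet) (hden y)
    · rw [h2]
      exact div_pos hdet (hden y)
  have hmono : StrictMono E := fun y z hyz => by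
    have := Real.exp_lt_exp.2 hyz
    simp only [E]
    rw [div_lt_div_iff₀ (hden y) (hden z)]
    nlinarith [mul_pos (sub_pos.2 this) hdet]
  have hexp : ∀ y, Real.exp y = (p * E y + q) / (r * E y + s) := fun y => by
    rw [h1, h2]
    have := (hden y).ne'
    have := hdet.ne'
    field_simp
  have hrange : range E = interior I := by
    refine Subset.antisymm (range_subset_iff.2 hE) fun x hx => ?_
    rw [hint] at hx
    obtain ⟨hx1, hx2⟩ := hx
    refine ⟨Real.log ((p * x + q) / (r * x + s)), ?_⟩
    have h3 := hden (Real.log ((p * x + q) / (r * x + s)))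
    simp only [E]
    rw [Real.exp_log (div_pos hx1 hx2)] at h3 ⊢
    rw [div_eq_iff h3.ne']
    linear_combination div_mul_cancel₀ (p * x + q) hx2.ne'
  refine ⟨fun y => ⟨E y, interior_subset (hE y)⟩,
    isLineChart_of_range_eq_interior hI (fun y z h => hmono h) hrange, ?_⟩
  rintro f ⟨A, B, C, D, hABCD, hf⟩ φ hφ
  -- These are the entries of the matrix of `f` conjugated by that of the chart, with the adjugate
  -- in place of the inverse; this multiplies the determinant by `(p * s - r * q) ^ 2`.
  refine ⟨(p * A + q * C) * s - (p * B + q * D) * r, (p * B + q * D) * p - (p * A + q * C) * q,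
    (r * A + s * C) * s - (r * B + s * D) * r, (r * B + s * D) * p - (r * A + s * C) * q, ?_,
    fun y => ?_⟩
  · have : ((p * A + q * C) * s - (p * B + q * D) * r) * ((r * B + s * D) * p - (r * A + s * C) * q)
        - ((p * B + q * D) * p - (p * A + q * C) * q) * ((r * A + s * C) * s - (r * B + s * D) * r)
        = (A * D - B * C) * (p * s - r * q) ^ 2 := by ring
    rw [this]
    exact mul_ne_zero hABCD (pow_ne_zero _ hdet.ne')
  · obtain ⟨h3, h4⟩ := hf ⟨E y, interior_subset (hE y)⟩
    rw [hφ] at h4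
    simp only at h3 h4
    have h5 := hexp (φ y)
    have h6 : 0 < r * E (φ y) + s := by
      rw [h2]
      exact div_pos hdet (hden _)
    have hd := hden y
    have hfE : E (φ y) * (C * E y + D) = A * E y + B := by rw [h4, div_mul_cancel₀ _ h3]
    have h7 : (p * E (φ y) + q) * (C * E y + D) * (p - Real.exp y * r) =
        ((p * A + q * C) * s - (p * B + q * D) * r) * Real.exp y +
        ((p * B + q * D) * p - (p * A + q * C) * q) := by
      linear_combination p * (p - Real.exp y * r) * hfE + (p * A + q * C) * hEden y
    have h8 : (r * E (φ y) + s) * (C * E y + D) * (p - Real.exp y * r) =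
        ((r * A + s * C) * s - (r * B + s * D) * r) * Real.exp y +
        ((r * B + s * D) * p - (r * A + s * C) * q) := by
      linear_combination r * (p - Real.exp y * r) * hfE + (r * A + s * C) * hEden y
    rw [← h7, ← h8, h5]
    refine ⟨by positivity, ?_⟩
    rw [mul_div_mul_right _ _ hd.ne', mul_div_mul_right _ _ h3]

/-! ### Continuity and monotonicity of Möbius maps -/

theorem IsMobius.continuous {I : Set ℝ} {f : I → I} (hf : IsMobius f) : Continuous f := by
  obtain ⟨A, B, C, D, -, h⟩ := hf
  rw [continuous_induced_rng]
  have e : Subtype.val ∘ f = fun x : I => (A * (x : ℝ) + B) / (C * (x : ℝ) + D) :=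
    funext fun x => (h x).2
  rw [e]
  exact Continuous.div (by fun_prop) (by fun_prop) fun x => (h x).1

/-- The denominator keeps one sign on the interval, so the sign of a difference of values is that of
`A * D - B * C` times the difference of arguments. -/
theorem IsMobius.strictMono_or_strictAnti {I : Set ℝ} (hI : I.OrdConnected) {f : I → I}
    (hf : IsMobius f) : StrictMono f ∨ StrictAnti f := by
  obtain ⟨A, B, C, D, hdet, h⟩ := hf
  have hpos : ∀ x y : I, 0 < (C * (x : ℝ) + D) * (C * (y : ℝ) + D) := fun x y => by
    by_contra! hle
    have hc : ContinuousOn (fun t : ℝ => C * t + D) I := by fun_prop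
    have h0 : ∃ t ∈ I, C * t + D = 0 := by
      rcases mul_nonpos_iff.1 hle with ⟨h1, h2⟩ | ⟨h1, h2⟩
      · exact hI.isPreconnected.intermediate_value y.2 x.2 hc ⟨h2, h1⟩
      · exact hI.isPreconnected.intermediate_value x.2 y.2 hc ⟨h1, h2⟩
    obtain ⟨t, ht, h0⟩ := h0
    exact (h ⟨t, ht⟩).1 h0
  have hsub : ∀ x y : I, ((f y : I) : ℝ) - f x =
      (A * D - B * C) * (y - x) / ((C * (x : ℝ) + D) * (C * (y : ℝ) + D)) := fun x y => by
    rw [(h x).2, (h y).2, div_sub_div _ _ (h y).1 (h x).1, mul_comm (C * (y : ℝ) + D) (C * (x : ℝ) + D)]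
    congr 1
    ring
  rcases hdet.lt_or_gt with hd | hd
  · refine Or.inr fun x y hxy => ?_
    have hxy' : (0 : ℝ) < y - x := sub_pos.2 hxy
    have := hsub x y ▸ div_neg_of_neg_of_pos (mul_neg_of_neg_of_pos hd hxy') (hpos x y)
    exact (sub_neg (α := ℝ)).1 this
  · refine Or.inl fun x y hxy => ?_
    have hxy' : (0 : ℝ) < y - x := sub_pos.2 hxy
    have := hsub x y ▸ div_pos (mul_pos hd hxy') (hpos x y)
    exact (sub_pos (α := ℝ)).1 this

/-! ### Orbits of the semigroup -/

section Orbit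

variable {I : Set ℝ} {f g : I → I} {x : I}

theorem mem_orbit_left : f x ∈ orbit f g x := ⟨f, Subsemigroup.subset_closure (Or.inl rfl), rfl⟩

theorem mem_orbit_right : g x ∈ orbit f g x := ⟨g, Subsemigroup.subset_closure (Or.inr rfl), rfl⟩

theorem mapsTo_orbit_left : MapsTo f (orbit f g x) (orbit f g x) := by
  rintro _ ⟨h, hh, rfl⟩
  exact ⟨f ∘ h, (semigroupGen f g).mul_mem (Subsemigroup.subset_closure (Or.inl rfl)) hh, rfl⟩

theorem mapsTo_orbit_right : MapsTo g (orbit f g x) (orbit f g x) := by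
  rintro _ ⟨h, hh, rfl⟩
  exact ⟨g ∘ h, (semigroupGen f g).mul_mem (Subsemigroup.subset_closure (Or.inr rfl)) hh, rfl⟩

theorem orbit_subset_of_mapsTo {S : Set I} (hf : MapsTo f S S) (hg : MapsTo g S S) (hx : x ∈ S) :
    orbit f g x ⊆ S := by
  rintro _ ⟨h, hh, rfl⟩
  have key : ∀ k : Function.End I, k ∈ semigroupGen f g → ∀ z ∈ S, k z ∈ S := by
    intro k hk
    induction hk using Subsemigroup.closure_induction with
    | mem k hk =>
      rcases hk with rfl | rfl
      · exact fun z hz => hf hz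
      · exact fun z hz => hg hz
    | mul k l _ _ ihk ihl => exact fun z hz => ihk _ (ihl z hz)
  exact key h hh x hx

theorem orbit_subset_range : orbit f g x ⊆ range f ∪ range g := by
  rintro _ ⟨h, hh, rfl⟩
  have key : ∀ k : Function.End I, k ∈ semigroupGen f g → ∀ z, k z ∈ range f ∪ range g := by
    intro k hk
    induction hk using Subsemigroup.closure_induction with
    | mem k hk =>
      rcases hk with rfl | rfl
      · exact fun z => Or.inl ⟨z, rfl⟩
      · exact fun z => Or.inr ⟨z, rfl⟩
    | mul k l _ _ ihk _ => exact fun z => ihk _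
  exact key h hh x

theorem orbit_comm : orbit f g x = orbit g f x :=
  congrArg (fun T : Set (Function.End I) =>
    {y | ∃ h : I → I, h ∈ Subsemigroup.closure T ∧ h x = y}) (pair_comm _ _)

end Orbit

/-! ### Transfer between the interval and the line -/

namespace IsLineChart

variable {I : Set ℝ} {e : ℝ → I} {f g : I → I} {φ ψ : ℝ → ℝ}

theorem injective (he : IsLineChart e) : Function.Injective e := he.strictMono.injective

/-- An end point is an extreme point of `I`, and a strictly monotone map cannot take an extreme
value at an interior point. -/
theorem exists_eq_map (he : IsLineChart e)
    (mf : StrictMono f ∨ StrictAnti f) (s : ℝ) : ∃ t, e t = f (e s) := by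
  have h1 := he.strictMono (sub_one_lt s)
  rcases he.trichotomy (f (e s)) with h | h | h
  · exfalso
    have : ∃ z, f z < f (e s) := by
      rcases mf with mf | mf
      · exact ⟨_, mf h1⟩
      · exact ⟨_, mf (he.strictMono (lt_add_one s))⟩
    obtain ⟨z, hz⟩ := this
    exact hz.ne (he.eq_of_lt _ _ (fun t => hz.trans (h t)) h)
  · exact h
  · exfalso
    have : ∃ z, f (e s) < f z := by
      rcases mf with mf | mf
      · exact ⟨_, mf (he.strictMono (lt_add_one s))⟩
      · exact ⟨_, mf h1⟩
    obtain ⟨z, hz⟩ := this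
    exact hz.ne (he.eq_of_gt _ _ h fun t => (h t).trans hz)

theorem strictMono_conj (he : IsLineChart e)
    (hφ : ∀ y, f (e y) = e (φ y)) (mf : StrictMono f) : StrictMono φ :=
  fun u v huv => he.strictMono.lt_iff_lt.1 (by rw [← hφ, ← hφ]; exact mf (he.strictMono huv))

theorem strictAnti_conj (he : IsLineChart e)
    (hφ : ∀ y, f (e y) = e (φ y)) (mf : StrictAnti f) : StrictAnti φ :=
  fun u v huv => he.strictMono.lt_iff_lt.1 (by rw [← hφ, ← hφ]; exact mf (he.strictMono huv))

theorem strictMono_conj_iff (he : IsLineChart e)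
    (hφ : ∀ y, f (e y) = e (φ y)) (mf : StrictMono f ∨ StrictAnti f) :
    StrictMono f ↔ StrictMono φ := by
  refine ⟨he.strictMono_conj hφ, fun h => mf.resolve_right fun h' => ?_⟩
  exact (h zero_lt_one).asymm (he.strictAnti_conj hφ h' zero_lt_one)

theorem strictAnti_conj_iff (he : IsLineChart e)
    (hφ : ∀ y, f (e y) = e (φ y)) (mf : StrictMono f ∨ StrictAnti f) :
    StrictAnti f ↔ StrictAnti φ := by
  refine ⟨he.strictAnti_conj hφ, fun h => mf.resolve_left fun h' => ?_⟩
  exact (h zero_lt_one).asymm (he.strictMono_conj hφ h' zero_lt_one)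

/-- Interior points are reached through `φ`. An end point belonging to `I` is fixed by an increasing
`f`, and is its own second image under a decreasing one. -/
theorem surjective_of_conj (he : IsLineChart e)
    (hφ : ∀ y, f (e y) = e (φ y)) (mf : StrictMono f ∨ StrictAnti f)
    (h : Function.Surjective φ) : Function.Surjective f := by
  have hle : ∀ s, ∃ t, f (e t) = e s := fun s => by
    obtain ⟨t, rfl⟩ := h s
    exact ⟨t, hφ t⟩
  have below : ∀ z, (∀ t, f z < f (e t)) → ∀ s, f z < e s := fun z hz s => by
    obtain ⟨t, ht⟩ := hle s
    exact ht ▸ hz t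
  have above : ∀ z, (∀ t, f (e t) < f z) → ∀ s, e s < f z := fun z hz s => by
    obtain ⟨t, ht⟩ := hle s
    exact ht ▸ hz t
  intro y
  rcases he.trichotomy y with hy | ⟨s, rfl⟩ | hy
  · rcases mf with mf | mf
    · exact ⟨y, he.eq_of_lt _ _ (below y fun t => mf (hy t)) hy⟩
    · have h1 := above y fun t => mf (hy t)
      exact ⟨f y, he.eq_of_lt _ _ (below (f y) fun t => mf (h1 t)) hy⟩
  · obtain ⟨t, ht⟩ := hle s
    exact ⟨_, ht⟩
  · rcases mf with mf | mf
    · exact ⟨y, he.eq_of_gt _ _ (above y fun t => mf (hy t)) hy⟩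
    · have h1 := below y fun t => mf (hy t)
      exact ⟨f y, he.eq_of_gt _ _ (above (f y) fun t => mf (h1 t)) hy⟩

theorem dense_preimage_iff (he : IsLineChart e) {S : Set I} : Dense (e ⁻¹' S) ↔ Dense S := by
  refine ⟨fun h => ?_, fun h => h.preimage he.isOpenEmbedding.isOpenMap⟩
  exact (he.denseRange.dense_image he.isOpenEmbedding.continuous h).mono (image_preimage_subset _ _)

theorem finite_compl_range (he : IsLineChart e) : (range e)ᶜ.Finite := by
  have h1 : {z : I | ∀ s, z < e s}.Subsingleton := fun z hz z' hz' => he.eq_of_lt z z' hz hz'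
  have h2 : {z : I | ∀ s, e s < z}.Subsingleton := fun z hz z' hz' => he.eq_of_gt z z' hz hz'
  refine (h1.finite.union h2.finite).subset fun z hz => ?_
  rcases he.trichotomy z with h | h | h
  · exact Or.inl h
  · exact absurd h hz
  · exact Or.inr h

theorem dense_range_iff (he : IsLineChart e)
    (hφ : ∀ y, f (e y) = e (φ y)) (hψ : ∀ y, g (e y) = e (ψ y)) :
    Dense (range f ∪ range g) ↔ Dense (range φ ∪ range ψ) := by
  rw [← he.dense_preimage_iff]
  refine ⟨fun h => ?_, fun h => h.mono ?_⟩
  -- Images of the end points add only finitely many points, and removing these keeps a subset of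
  -- the line dense.
  · have hfin : (e ⁻¹' (f '' (range e)ᶜ ∪ g '' (range e)ᶜ)).Finite :=
      ((he.finite_compl_range.image f).union (he.finite_compl_range.image g)).preimage
        he.injective.injOn
    refine (h.sdiff_finite hfin).mono ?_
    rintro y ⟨⟨z, hz⟩ | ⟨z, hz⟩, hy⟩
    · by_cases hze : z ∈ range e
      · obtain ⟨s, rfl⟩ := hze
        exact Or.inl ⟨s, he.injective (by rw [← hφ, hz])⟩
      · exact absurd (Or.inl ⟨z, hze, hz⟩) hy
    · by_cases hze : z ∈ range e
      · obtain ⟨s, rfl⟩ := hze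
        exact Or.inr ⟨s, he.injective (by rw [← hψ, hz])⟩
      · exact absurd (Or.inr ⟨z, hze, hz⟩) hy
  · rintro _ (⟨y, rfl⟩ | ⟨y, rfl⟩)
    · exact Or.inl ⟨e y, hφ y⟩
    · exact Or.inr ⟨e y, hψ y⟩

theorem exists_lt_of_bddBelow (he : IsLineChart e) (hφ : ∀ y, f (e y) = e (φ y)) (hf : Continuous f)
    (h : BddBelow (range φ)) (z : I) : ∃ s, e s < f z := by
  obtain ⟨m, hm⟩ := h
  refine ⟨m - 1, (he.strictMono (sub_one_lt m)).trans_le ?_⟩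
  refine he.denseRange.induction_on (p := fun z => e m ≤ f z) z
    (isClosed_le continuous_const hf) fun y => ?_
  rw [hφ]
  exact he.strictMono.monotone (hm ⟨y, rfl⟩)

theorem exists_gt_of_bddAbove (he : IsLineChart e) (hφ : ∀ y, f (e y) = e (φ y)) (hf : Continuous f)
    (h : BddAbove (range φ)) (z : I) : ∃ s, f z < e s := by
  obtain ⟨m, hm⟩ := h
  refine ⟨m + 1, lt_of_le_of_lt ?_ (he.strictMono (lt_add_one m))⟩
  refine he.denseRange.induction_on (p := fun z => f z ≤ e m) z
    (isClosed_le hf continuous_const) fun y => ?_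
  rw [hφ]
  exact he.strictMono.monotone (hm ⟨y, rfl⟩)

/-- An orbit reaches the interior. -/
theorem exists_mem_orbit (he : IsLineChart e)
    (hφ : ∀ y, f (e y) = e (φ y)) (hψ : ∀ y, g (e y) = e (ψ y))
    (hf : Continuous f) (hg : Continuous g) (inj : Function.Injective f)
    (h1 : BddAbove (range φ)) (h2 : BddBelow (range ψ)) (x : I) :
    ∃ s, e s ∈ orbit f g x := by
  -- If the orbit stayed at end points, its values of `f` would all be the left one and its values
  -- of `g` the right one. Then `f (f x) = f (g x)`, so `f x = g x` by injectivity, although these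
  -- are opposite ends.
  by_contra! hcon
  have hout : ∀ z ∈ orbit f g x, ∀ s, e s ≠ z := fun z hz s h => hcon s (h ▸ hz)
  have hlow : ∀ z, f z ∈ orbit f g x → ∀ s, f z < e s := fun z hz => by
    rcases he.trichotomy (f z) with h | ⟨s, h⟩ | h
    · exact h
    · exact absurd h (hout _ hz s)
    · obtain ⟨s, hs⟩ := he.exists_gt_of_bddAbove hφ hf h1 z
      exact absurd hs (h s).not_gt
  have hhigh : ∀ z, g z ∈ orbit f g x → ∀ s, e s < g z := fun z hz => by
    rcases he.trichotomy (g z) with h | ⟨s, h⟩ | h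
    · obtain ⟨s, hs⟩ := he.exists_lt_of_bddBelow hψ hg h2 z
      exact absurd hs (h s).not_gt
    · exact absurd h (hout _ hz s)
    · exact h
  have hff := hlow _ (mapsTo_orbit_left (mem_orbit_left (f := f) (g := g) (x := x)))
  have hfg := hlow _ (mapsTo_orbit_left (mem_orbit_right (f := f) (g := g) (x := x)))
  have heq := inj (he.eq_of_lt _ _ hff hfg)
  have hl := hlow _ (mem_orbit_left (f := f) (g := g) (x := x)) 0
  have hh := hhigh _ (mem_orbit_right (f := f) (g := g) (x := x)) 0
  exact (hl.trans hh).ne heq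

theorem tendsto_atBot (he : IsLineChart e) :
    Tendsto (fun y => ((e y : ℝ) : EReal)) atBot (𝓝 (sInf (extSet I))) := by
  have hm : Monotone fun y => ((e y : ℝ) : EReal) := fun u v h =>
    EReal.coe_le_coe_iff.2 (he.strictMono.monotone h)
  convert tendsto_atBot_iInf hm using 2
  refine le_antisymm (le_iInf fun y => sInf_le ⟨_, (e y).2, rfl⟩) (le_sInf ?_)
  rintro _ ⟨z, hz, rfl⟩
  exact he.denseRange.induction_on
    (p := fun z : I => (⨅ y, ((e y : ℝ) : EReal)) ≤ ((z : ℝ) : EReal)) ⟨z, hz⟩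
    (isClosed_le continuous_const (continuous_coe_real_ereal.comp continuous_subtype_val))
    fun y => iInf_le _ y

theorem tendsto_atTop (he : IsLineChart e) :
    Tendsto (fun y => ((e y : ℝ) : EReal)) atTop (𝓝 (sSup (extSet I))) := by
  have hm : Monotone fun y => ((e y : ℝ) : EReal) := fun u v h =>
    EReal.coe_le_coe_iff.2 (he.strictMono.monotone h)
  convert tendsto_atTop_iSup hm using 2
  refine le_antisymm (sSup_le ?_) (iSup_le fun y => le_sSup ⟨_, (e y).2, rfl⟩)
  rintro _ ⟨z, hz, rfl⟩
  exact he.denseRange.induction_on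
    (p := fun z : I => ((z : ℝ) : EReal) ≤ ⨆ y, ((e y : ℝ) : EReal)) ⟨z, hz⟩
    (isClosed_le (continuous_coe_real_ereal.comp continuous_subtype_val) continuous_const)
    fun y => le_iSup (fun y => ((e y : ℝ) : EReal)) y

theorem iterate_conj (hφ : ∀ y, f (e y) = e (φ y)) (n : ℕ) (y : ℝ) :
    f^[n] (e y) = e (φ^[n] y) :=
  ((show Function.Semiconj e φ f from fun y => (hφ y).symm).iterate_right n y).symm

theorem sInf_lt (he : IsLineChart e) (y : ℝ) : sInf (extSet I) < ((e y : ℝ) : EReal) :=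
  lt_of_le_of_lt (sInf_le ⟨_, (e (y - 1)).2, rfl⟩)
    (EReal.coe_lt_coe_iff.2 (he.strictMono (sub_one_lt y)))

theorem lt_sSup (he : IsLineChart e) (y : ℝ) : ((e y : ℝ) : EReal) < sSup (extSet I) :=
  lt_of_lt_of_le (EReal.coe_lt_coe_iff.2 (he.strictMono (lt_add_one y)))
    (le_sSup ⟨_, (e (y + 1)).2, rfl⟩)

/-- If `φ y ≥ y` for some `y`, then points further left never move left, and their iterates stay
away from the left end. Otherwise the iterates tend to `-∞` in the chart. -/
theorem isAttracting_sInf_iff (he : IsLineChart e) (hφ : ∀ y, f (e y) = e (φ y)) (mf : StrictMono f)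
    (hc : StrictlyContracting φ) :
    IsAttracting f (sInf (extSet I)) ↔ ∀ y, φ y < y := by
  have mφ := he.strictMono_conj hφ mf
  constructor
  · rintro ⟨-, U, hU, hconv⟩
    by_contra! hcon
    obtain ⟨y, hy⟩ := hcon
    obtain ⟨z, hz, hzy⟩ := ((he.tendsto_atBot.eventually hU).and (eventually_le_atBot y)).exists
    have hz' := hc.le_of_le hy hzy
    have hlim := hconv (e z) hz
    simp only [iterate_conj hφ] at hlim
    refine (he.sInf_lt z).not_ge (ge_of_tendsto hlim (Eventually.of_forall fun n => ?_))
    exact EReal.coe_le_coe_iff.2 (he.strictMono.monotone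
      ((mφ.monotone.monotone_iterate_of_le_map hz') n.zero_le))
  · intro hlt
    have hne : (extSet I).Nonempty := ⟨_, _, (e 0).2, rfl⟩
    refine ⟨csInf_mem_closure hne (OrderBot.bddBelow _), Iio ((e 0 : ℝ) : EReal),
      Iio_mem_nhds (he.sInf_lt 0), fun x hx => ?_⟩
    rcases he.trichotomy x with h | ⟨s, rfl⟩ | h
    -- A left end point belonging to `I` is fixed, so its constant orbit converges too.
    · have hfix : f x = x := by
        refine he.eq_of_lt _ _ (fun s => ?_) h
        have := mf (h s)
        rw [hφ] at this
        exact this.trans (he.strictMono (hlt s))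
      have hx' : ((x : ℝ) : EReal) = sInf (extSet I) := by
        refine le_antisymm ?_ (sInf_le ⟨_, x.2, rfl⟩)
        exact ge_of_tendsto he.tendsto_atBot (Eventually.of_forall fun s =>
          EReal.coe_le_coe_iff.2 (h s).le)
      simp only [Function.iterate_fixed hfix, hx']
      exact tendsto_const_nhds
    · simp only [iterate_conj hφ]
      exact he.tendsto_atBot.comp (tendsto_iterate_atBot hc.continuous hlt s)
    · exact absurd (EReal.coe_lt_coe_iff.1 hx) (show ¬ x < e 0 from (h 0).not_gt)

theorem isAttracting_sSup_iff (he : IsLineChart e) (hφ : ∀ y, f (e y) = e (φ y)) (mf : StrictMono f)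
    (hc : StrictlyContracting φ) :
    IsAttracting f (sSup (extSet I)) ↔ ∀ y, y < φ y := by
  have mφ := he.strictMono_conj hφ mf
  constructor
  · rintro ⟨-, U, hU, hconv⟩
    by_contra! hcon
    obtain ⟨y, hy⟩ := hcon
    obtain ⟨z, hz, hzy⟩ := ((he.tendsto_atTop.eventually hU).and (eventually_ge_atTop y)).exists
    have hz' := hc.ge_of_ge hy hzy
    have hlim := hconv (e z) hz
    simp only [iterate_conj hφ] at hlim
    refine (he.lt_sSup z).not_ge (le_of_tendsto hlim (Eventually.of_forall fun n => ?_))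
    exact EReal.coe_le_coe_iff.2 (he.strictMono.monotone
      ((mφ.monotone.antitone_iterate_of_map_le hz') n.zero_le))
  · intro hlt
    have hne : (extSet I).Nonempty := ⟨_, _, (e 0).2, rfl⟩
    refine ⟨csSup_mem_closure hne (OrderTop.bddAbove _), Ioi ((e 0 : ℝ) : EReal),
      Ioi_mem_nhds (he.lt_sSup 0), fun x hx => ?_⟩
    rcases he.trichotomy x with h | ⟨s, rfl⟩ | h
    · exact absurd (EReal.coe_lt_coe_iff.1 hx) (show ¬ e 0 < x from (h 0).not_gt)
    · simp only [iterate_conj hφ]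
      exact he.tendsto_atTop.comp (tendsto_iterate_atTop hc.continuous hlt s)
    · have hfix : f x = x := by
        refine he.eq_of_gt _ _ (fun s => ?_) h
        have := mf (h s)
        rw [hφ] at this
        exact (he.strictMono (hlt s)).trans this
      have hx' : ((x : ℝ) : EReal) = sSup (extSet I) := by
        refine le_antisymm (le_sSup ⟨_, x.2, rfl⟩) ?_
        exact le_of_tendsto he.tendsto_atTop (Eventually.of_forall fun s =>
          EReal.coe_le_coe_iff.2 (h s).le)
      simp only [Function.iterate_fixed hfix, hx']
      exact tendsto_const_nhds

theorem attractingMemEndPoints_iff (he : IsLineChart e)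
    (hφ : ∀ y, f (e y) = e (φ y)) (mf : StrictMono f)
    (hc : StrictlyContracting φ) : AttractingMemEndPoints f ↔ PushesToEnd φ := by
  rw [PushesToEnd, ← he.isAttracting_sInf_iff hφ mf hc, ← he.isAttracting_sSup_iff hφ mf hc]
  constructor
  · rintro ⟨p, hp, rfl | rfl⟩
    · exact Or.inl hp
    · exact Or.inr hp
  · rintro (h | h)
    · exact ⟨_, h, Or.inl rfl⟩
    · exact ⟨_, h, Or.inr rfl⟩

theorem attractingPairEqEndPoints_iff (he : IsLineChart e)
    (hφ : ∀ y, f (e y) = e (φ y)) (hψ : ∀ y, g (e y) = e (ψ y))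
    (mf : StrictMono f) (mg : StrictMono g) (hc : StrictlyContracting φ)
    (hc' : StrictlyContracting ψ) : AttractingPairEqEndPoints f g ↔ PushesApart φ ψ := by
  rw [PushesApart, ← he.isAttracting_sInf_iff hφ mf hc, ← he.isAttracting_sSup_iff hφ mf hc,
    ← he.isAttracting_sInf_iff hψ mg hc', ← he.isAttracting_sSup_iff hψ mg hc']
  constructor
  · rintro ⟨p, q, hp, hq, hpq⟩
    rcases pair_eq_pair_iff.1 hpq with ⟨rfl, rfl⟩ | ⟨rfl, rfl⟩
    · exact Or.inl ⟨hp, hq⟩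
    · exact Or.inr ⟨hp, hq⟩
  · rintro (h | h)
    · exact ⟨_, _, h.1, h.2, rfl⟩
    · exact ⟨_, _, h.1, h.2, pair_comm _ _⟩

theorem dynamicalCondition_iff (he : IsLineChart e)
    (hφ : ∀ y, f (e y) = e (φ y)) (hψ : ∀ y, g (e y) = e (ψ y))
    (mf : StrictMono f ∨ StrictAnti f) (mg : StrictMono g ∨ StrictAnti g)
    (hc : StrictlyContracting φ) (hc' : StrictlyContracting ψ) :
    DynamicalCondition f g ↔ LineDynamicalCondition φ ψ := by
  have hnot : ∀ {h : I → I}, StrictMono h → StrictAnti h → False := fun h1 h2 => by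
    have := he.strictMono (zero_lt_one (α := ℝ))
    exact (h1 this).asymm (h2 this)
  have hanti : ∀ {h : I → I}, (StrictMono h ∨ StrictAnti h) → (¬ StrictMono h ↔ StrictAnti h) :=
    fun h => ⟨fun h' => h.resolve_left h', fun h1 h2 => hnot h2 h1⟩
  rw [DynamicalCondition, LineDynamicalCondition, hanti mf, hanti mg,
    ← he.strictMono_conj_iff hφ mf, ← he.strictMono_conj_iff hψ mg,
    ← he.strictAnti_conj_iff hφ mf, ← he.strictAnti_conj_iff hψ mg]
  have hφψ : ∀ y, (f ∘ g) (e y) = e ((φ ∘ ψ) y) := fun y => by simp [hφ, hψ]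
  have hψφ : ∀ y, (g ∘ f) (e y) = e ((ψ ∘ φ) y) := fun y => by simp [hφ, hψ]
  refine or_congr ?_ (or_congr (or_congr ?_ ?_) ?_)
  · exact and_congr_right fun h1 => and_congr_right fun h2 =>
      he.attractingPairEqEndPoints_iff hφ hψ h1 h2 hc hc'
  · exact and_congr_right fun h1 => and_congr_right fun _ =>
      he.attractingMemEndPoints_iff hφ h1 hc
  · exact and_congr_right fun h1 => and_congr_right fun _ =>
      he.attractingMemEndPoints_iff hψ h1 hc'
  -- Compositions of two decreasing maps are increasing contractions, so the increasing case applies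
  -- to them.
  · exact and_congr_right fun h1 => and_congr_right fun h2 =>
      he.attractingPairEqEndPoints_iff hφψ hψφ (h1.comp h2) (h2.comp h1)
        (hc.comp hc') (hc'.comp hc)

end IsLineChart

/-! ### Conclusion -/

theorem dense_orbit_iff {I : Set ℝ} (hI : I.OrdConnected) (hI' : I ≠ univ)
    {f g : I → I} (hf : IsMobius f) (hg : IsMobius g)
    (hf' : ¬ Function.Surjective f) (hg' : ¬ Function.Surjective g) (x : I) :
    Dense (orbit f g x) ↔ Dense (range f ∪ range g) ∧ DynamicalCondition f g := by
  have hn : I.Nontrivial := by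
    by_contra h
    have := (not_nontrivial_iff.1 h).coe_sort
    exact hf' fun y => ⟨y, Subsingleton.elim _ _⟩
  have mf := hf.strictMono_or_strictAnti hI
  have mg := hg.strictMono_or_strictAnti hI
  have inj : ∀ {h : I → I}, (StrictMono h ∨ StrictAnti h) → Function.Injective h := fun h =>
    h.elim (fun h => h.injective) (fun h => h.injective)
  obtain ⟨e, he, hmob⟩ := exists_isLineChart hI hI' hn
  choose φ hφ using he.exists_eq_map mf
  choose ψ hψ using he.exists_eq_map mg
  replace hφ : ∀ y, f (e y) = e (φ y) := fun y => (hφ y).symm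
  replace hψ : ∀ y, g (e y) = e (ψ y) := fun y => (hψ y).symm
  have sφ := mt (he.surjective_of_conj hφ mf) hf'
  have sψ := mt (he.surjective_of_conj hψ mg) hg'
  have cφ := (hmob f hf φ hφ).strictlyContracting sφ
  have cψ := (hmob g hg ψ hψ).strictlyContracting sψ
  have mφ := mf.imp (he.strictMono_conj hφ) (he.strictAnti_conj hφ)
  have mψ := mg.imp (he.strictMono_conj hψ) (he.strictAnti_conj hψ)
  rw [he.dynamicalCondition_iff hφ hψ mf mg cφ cψ, he.dense_range_iff hφ hψ]
  constructor
  · intro hd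
    have hr := (he.dense_range_iff hφ hψ).1 (hd.mono orbit_subset_range)
    refine ⟨hr, ?_⟩
    by_contra hcon
    let E : Set I := (range e)ᶜ
    -- The trap `J` must contain `x` and the images of the end points, so far as these lie in the
    -- chart; then `E ∪ e '' J` is invariant and contains the orbit.
    have hfin : (e ⁻¹' (insert x (f '' E ∪ g '' E))).Finite :=
      (((he.finite_compl_range.image f).union (he.finite_compl_range.image g)).insert x).preimage
        he.injective.injOn
    obtain ⟨J, hXJ, hJf, hJg, hJ⟩ := exists_mapsTo_of_not_lineDynamicalCondition cφ cψ sφ sψ mφ mψ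
      hr hcon hfin.bddBelow hfin.bddAbove
    have hmem : ∀ z, z ∈ insert x (f '' E ∪ g '' E) → z ∈ E ∪ e '' J := fun z hz => by
      by_cases hze : z ∈ range e
      · obtain ⟨s, rfl⟩ := hze
        exact Or.inr ⟨s, hXJ hz, rfl⟩
      · exact Or.inl hze
    have hSf : MapsTo f (E ∪ e '' J) (E ∪ e '' J) := by
      rintro z (hz | ⟨s, hs, rfl⟩)
      · exact hmem _ (Or.inr (Or.inl ⟨z, hz, rfl⟩))
      · exact Or.inr ⟨_, hJf hs, (hφ s).symm⟩
    have hSg : MapsTo g (E ∪ e '' J) (E ∪ e '' J) := by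
      rintro z (hz | ⟨s, hs, rfl⟩)
      · exact hmem _ (Or.inr (Or.inr ⟨z, hz, rfl⟩))
      · exact Or.inr ⟨_, hJg hs, (hψ s).symm⟩
    have hS := hd.mono (orbit_subset_of_mapsTo hSf hSg (hmem x (Or.inl rfl)))
    refine hJ ((he.dense_preimage_iff.2 hS).mono ?_)
    rintro s (hs | ⟨t, ht, hts⟩)
    · exact absurd ⟨s, rfl⟩ hs
    · exact he.injective hts ▸ ht
  · rintro ⟨hr, hD⟩
    -- The starting point may be an end point, so the orbit has to be seen to enter the chart.
    have hne : (e ⁻¹' orbit f g x).Nonempty := by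
      rcases bdd_range_of_dense cφ.continuous cψ.continuous sφ sψ hr with ⟨h1, -, h2, -⟩ | ⟨h1, -, h2, -⟩
      · exact he.exists_mem_orbit hφ hψ hf.continuous hg.continuous (inj mf) h1 h2 x
      · obtain ⟨s, hs⟩ := he.exists_mem_orbit hψ hφ hg.continuous hf.continuous (inj mg) h1 h2 x
        refine ⟨s, ?_⟩
        rwa [mem_preimage, orbit_comm]
    refine he.dense_preimage_iff.1 (dense_of_mapsTo cφ cψ sφ sψ hr hD hne ?_ ?_)
    · intro s hs
      have := mapsTo_orbit_left hs
      rwa [hφ] at this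
    · intro s hs
      have := mapsTo_orbit_right hs
      rwa [hψ] at this

theorem theorem1 (I : Set ℝ) (hI : I.OrdConnected) (hI' : I ≠ Set.univ)
    (f g : I → I) (hf : IsMobius f) (hg : IsMobius g)
    (hf' : ¬ Function.Surjective f) (hg' : ¬ Function.Surjective g) (x : I) :
    (Dense (orbit f g x) ↔
      Dense (Set.range f ∪ Set.range g) ∧ DynamicalCondition f g) ∧
    (IsCompact I →
      (Dense (orbit f g x) ↔
        Set.range f ∪ Set.range g = Set.univ ∧ DynamicalCondition f g)) := by
  have h := dense_orbit_iff hI hI' hf hg hf' hg' x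
  refine ⟨h, fun hc => ?_⟩
  have := isCompact_iff_compactSpace.1 hc
  have hcl : IsClosed (range f ∪ range g) :=
    ((isCompact_range hf.continuous).union (isCompact_range hg.continuous)).isClosed
  rw [h, dense_iff_closure_eq, hcl.closure_eq]
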